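/- Let $M$ be a $C^\infty$ manifold of dimension $n\ge 2$ and let $\mathcal D\subseteq TM\setminus 0$ be an open set, closed under multiplication of vectors by positive numbers, which meets every tangent space (for example $\mathcal D=TM\setminus 0$). A Finsler function on $\mathcal D$ is a positive $C^\infty$ function $L(x,y)$ on $\mathcal D$, positively homogeneous of degree one in $y$, for which the matrix $g_{ij}=\tfrac12\dot\partial_i\dot\partial_jL^2$ is invertible; here $\partial_i=\partial/\partial x^i$, $\dot\partial_i=\partial/\partial y^i$. Put $\gamma^i_{jk}=\tfrac12 g^{ir}(\partial_jg_{kr}+\partial_kg_{jr}-\partial_rg_{jk})$, $G^i=\tfrac12\gamma^i_{jk}y^jy^k$, $N^i_j=\dot\partial_jG^i$, $\delta_i=\partial_i-N^r_i\dot\partial_r$, and let $\Gamma^i_{jk}=\tfrac12 g^{ir}(\delta_jg_{kr}+\delta_kg_{jr}-\delta_rg_{jk})$ be the horizontal coefficients of the Cartan connection. Let $L$ be a Finsler function on $\mathcal D$, let $\sigma$ be a $C^\infty$ function on $M$, and let $\beta=b_i(x)\,dx^i$ be a $C^\infty$ one-form on $M$, regarded as the function $\beta(x,y)=b_i(x)y^i$.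 Let $f$ be a $C^\infty$ function of two real variables, positively homogeneous of degree one, on an open cone of $\mathbb R^2$ which contains all the points $(e^{\sigma(x)}L(x,y),\beta(x,y))$, $(x,y)\in\mathcal D$, and suppose that $\overline L(x,y)=f(e^{\sigma(x)}L(x,y),\beta(x,y))$ is again a Finsler function on $\mathcal D$ (a generalized $\beta$-conformal change of $L$). Let $\overline\Gamma^i_{jk}$ be the Cartan connection coefficients of $\overline L$ and let $D^i_{jk}=\overline\Gamma^i_{jk}-\Gamma^i_{jk}$ be the difference tensor. Consider the assertions (i) $b_i$ is Cartan-parallel: $b_{j|k}:=\delta_kb_j-b_r\Gamma^r_{jk}=0$ on $\mathcal D$; (ii) $D^i_{jk}$ vanishes identically on $\mathcal D$. Call $\sigma$ homothetic if it is constant on each connected component of $M$ (hence constant if $M$ is connected). Then: (a) If (i) and (ii) hold, then $\sigma$ is homothetic. (b) If $\sigma$ is homothetic, then (i) implies (ii); and (ii) implies (i), so that (i) and (ii) are equivalent, provided that $f$ depends effectively on $\beta$ in the following sense: the function $(x,y)\mapsto\frac{\partial f}{\partial\beta}(e^{\sigma(x)}L(x,y),\beta(x,y))$ does not vanish identically on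 any nonempty open subset of $\{(x,y)\in\mathcal D : b(x)\ne 0\}$. -/

import Mathlib

open scoped Manifold ContDiff

noncomputable section

namespace Finsler

/-- The coordinate space `ℝⁿ`. -/
abbrev Coord (n : ℕ) := EuclideanSpace ℝ (Fin n)

section Coordinates

/-! ### Finsler geometry in local coordinates `(xⁱ, yⁱ)`

A scalar on (part of) the tangent bundle is, in a coordinate domain, a function `F x y`. -/

variable {n : ℕ}

/-- `∂ᵢ F`: partial derivative with respect to `xⁱ`. -/
def pdx (i : Fin n) (F : Coord n → Coord n → ℝ) (x y : Coord n) : ℝ :=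
  fderiv ℝ (fun u => F u y) x (EuclideanSpace.single i 1)

/-- `∂̇ᵢ F`: partial derivative with respect to `yⁱ`. -/
def pdy (i : Fin n) (F : Coord n → Coord n → ℝ) (x y : Coord n) : ℝ :=
  fderiv ℝ (fun v => F x v) y (EuclideanSpace.single i 1)

/-- The Finsler metric tensor `gᵢⱼ = ½ ∂̇ᵢ ∂̇ⱼ L²`. -/
def metric (L : Coord n → Coord n → ℝ) (x y : Coord n) : Matrix (Fin n) (Fin n) ℝ :=
  Matrix.of fun i j => (1 / 2) * pdy i (pdy j (fun u v => L u v ^ 2)) x y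

/-- The components `gⁱʲ` of the inverse matrix of `gᵢⱼ`. -/
def metricInv (L : Coord n → Coord n → ℝ) (x y : Coord n) : Matrix (Fin n) (Fin n) ℝ :=
  (metric L x y)⁻¹

/-- `γⁱⱼₖ = ½ gⁱʳ (∂ⱼ gₖᵣ + ∂ₖ gⱼᵣ - ∂ᵣ gⱼₖ)`. -/
def christoffel (L : Coord n → Coord n → ℝ) (i j k : Fin n) (x y : Coord n) : ℝ :=
  (1 / 2) * ∑ r, metricInv L x y i r *
    (pdx j (fun u v => metric L u v k r) x y + pdx k (fun u v => metric L u v j r) x y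
      - pdx r (fun u v => metric L u v j k) x y)

/-- The canonical spray `Gʰ = ½ γʰᵢⱼ yⁱ yʲ`. -/
def spray (L : Coord n → Coord n → ℝ) (h : Fin n) (x y : Coord n) : ℝ :=
  (1 / 2) * ∑ i, ∑ j, christoffel L h i j x y * y i * y j

/-- The Barthel (Cartan nonlinear) connection `Nⁱⱼ = ∂̇ⱼ Gⁱ`. -/
def barthel (L : Coord n → Coord n → ℝ) (i j : Fin n) (x y : Coord n) : ℝ :=
  pdy j (spray L i) x y

/-- `δⱼ F = ∂ⱼ F - Nʳⱼ ∂̇ᵣ F`. -/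
def delta (L : Coord n → Coord n → ℝ) (j : Fin n) (F : Coord n → Coord n → ℝ)
    (x y : Coord n) : ℝ :=
  pdx j F x y - ∑ r, barthel L r j x y * pdy r F x y

/-- The horizontal coefficients of the Cartan connection,
`Γⁱⱼₖ = ½ gⁱʳ (δⱼ gₖᵣ + δₖ gⱼᵣ - δᵣ gⱼₖ)`. -/
def cartan (L : Coord n → Coord n → ℝ) (i j k : Fin n) (x y : Coord n) : ℝ :=
  (1 / 2) * ∑ r, metricInv L x y i r *
    (delta L j (fun u v => metric L u v k r) x y + delta L k (fun u v => metric L u v j r) x y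
      - delta L r (fun u v => metric L u v j k) x y)

/-- The difference tensor `Dⁱⱼₖ = Γ̄ⁱⱼₖ - Γⁱⱼₖ` of the Cartan connections of `L` and `L'`. -/
def differenceTensor (L L' : Coord n → Coord n → ℝ) (i j k : Fin n) (x y : Coord n) : ℝ :=
  cartan L' i j k x y - cartan L i j k x y

/-- The horizontal covariant derivative `b_{j|k} = δₖ bⱼ - bᵣ Γʳⱼₖ`, with respect to the Cartan
connection, of a covector field with components `bⱼ(x)`. -/
def hCovDeriv (L : Coord n → Coord n → ℝ) (b : Fin n → Coord n → ℝ) (j k : Fin n)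
    (x y : Coord n) : ℝ :=
  delta L k (fun u _ => b j u) x y - ∑ r, b r x * cartan L r j k x y

end Coordinates

section Manifold

/-! ### Finsler functions on a manifold -/

variable {n : ℕ} {M : Type*} [TopologicalSpace M] [ChartedSpace (Coord n) M]

/-- The tangent vector `yⁱ ∂ᵢ` at the point with coordinates `x`, in the chart `φ`. -/
def tangentPoint (φ : OpenPartialHomeomorph M (Coord n)) (x y : Coord n) :
    TangentBundle (𝓡 n) M :=
  ⟨φ.symm x, mfderiv (𝓡 n) (𝓡 n) φ.symm x y⟩

/-- Coordinate expression, in the chart `φ`, of a function on the tangent bundle. -/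
def localRep (φ : OpenPartialHomeomorph M (Coord n)) (F : TangentBundle (𝓡 n) M → ℝ) :
    Coord n → Coord n → ℝ :=
  fun x y => F (tangentPoint φ x y)

/-- Components `bᵢ(x)`, in the chart `φ`, of a one-form. -/
def localCovector (φ : OpenPartialHomeomorph M (Coord n))
    (b : ∀ p : M, TangentSpace (𝓡 n) p →L[ℝ] ℝ) (i : Fin n) (x : Coord n) : ℝ :=
  b (φ.symm x) (mfderiv (𝓡 n) (𝓡 n) φ.symm x (EuclideanSpace.single i 1))

variable [IsManifold (𝓡 n) ∞ M]

/-- An open conic set of nonzero tangent vectors which meets every tangent space; the whole slit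
tangent bundle is the standard example. -/
structure IsConicDomain (𝒟 : Set (TangentBundle (𝓡 n) M)) : Prop where
  isOpen : IsOpen 𝒟
  ne_zero : ∀ v ∈ 𝒟, v.2 ≠ 0
  smul_mem : ∀ v ∈ 𝒟, ∀ t : ℝ, 0 < t → (⟨v.1, t • v.2⟩ : TangentBundle (𝓡 n) M) ∈ 𝒟
  nonempty : ∀ p : M, ∃ w : TangentSpace (𝓡 n) p, (⟨p, w⟩ : TangentBundle (𝓡 n) M) ∈ 𝒟

/-- `L` is a (smooth) Finsler function on `𝒟`: positive, positively homogeneous of degree one on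
the fibres, with nondegenerate metric tensor `gᵢⱼ`. -/
structure IsFinslerFunction (𝒟 : Set (TangentBundle (𝓡 n) M))
    (L : TangentBundle (𝓡 n) M → ℝ) : Prop where
  smooth : ContMDiffOn (𝓡 n).tangent 𝓘(ℝ, ℝ) ∞ L 𝒟
  pos : ∀ v ∈ 𝒟, 0 < L v
  homogeneous : ∀ v ∈ 𝒟, ∀ t : ℝ, 0 < t → L ⟨v.1, t • v.2⟩ = t * L v
  nondegenerate : ∀ φ ∈ IsManifold.maximalAtlas (𝓡 n) ∞ M, ∀ x ∈ φ.target, ∀ y : Coord n,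
    tangentPoint φ x y ∈ 𝒟 → (metric (localRep φ L) x y).det ≠ 0

/-- `b` is Cartan-parallel on `𝒟`: `b_{j|k} = 0` in all charts. -/
def IsCartanParallel (𝒟 : Set (TangentBundle (𝓡 n) M)) (L : TangentBundle (𝓡 n) M → ℝ)
    (b : ∀ p : M, TangentSpace (𝓡 n) p →L[ℝ] ℝ) : Prop :=
  ∀ φ ∈ IsManifold.maximalAtlas (𝓡 n) ∞ M, ∀ x ∈ φ.target, ∀ y : Coord n,
    tangentPoint φ x y ∈ 𝒟 → ∀ j k : Fin n,
      hCovDeriv (localRep φ L) (localCovector φ b) j k x y = 0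

/-- The difference tensor of the Cartan connections of `L` and `L'` vanishes identically on `𝒟`. -/
def DifferenceTensorVanishes (𝒟 : Set (TangentBundle (𝓡 n) M))
    (L L' : TangentBundle (𝓡 n) M → ℝ) : Prop :=
  ∀ φ ∈ IsManifold.maximalAtlas (𝓡 n) ∞ M, ∀ x ∈ φ.target, ∀ y : Coord n,
    tangentPoint φ x y ∈ 𝒟 → ∀ i j k : Fin n,
      differenceTensor (localRep φ L) (localRep φ L') i j k x y = 0

/-- The transformed function `L̄ = f(e^σ L, β)`, where `β(x, y) = bᵢ(x) yⁱ`. -/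
def betaConformalChange (f : ℝ × ℝ → ℝ) (σ : M → ℝ)
    (b : ∀ p : M, TangentSpace (𝓡 n) p →L[ℝ] ℝ) (L : TangentBundle (𝓡 n) M → ℝ) :
    TangentBundle (𝓡 n) M → ℝ :=
  fun v => f (Real.exp (σ v.1) * L v, b v.1 v.2)

end Manifold

/-- `σ` is homothetic: constant (on each connected component, if `M` is not connected). -/
def IsHomothetic {M : Type*} [TopologicalSpace M] (σ : M → ℝ) : Prop :=
  ∀ p q : M, q ∈ connectedComponent p → σ q = σ p

end Finsler

end

/-! Write `E = L²`, `A = e^σ L`, a bar for the changed function, and `f₁`, `f₂` for the partial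
derivatives of `f`. The argument rests on four properties of the Cartan connection, all obtained
from Euler's relations: `δₖE = 0`; `Γⁱⱼₖyʲ = Nⁱₖ`; the connection is symmetric and `h`-metrical; it
is the only one that is (`delta_energy`, `cartan_mul_fibreCoord`, `delta_metric_eq`, `eq_cartan`).
Consequently `L`, `∂̇ᵢL` and `∂̇ᵢ∂̇ⱼL` are all `h`-parallel.

If the difference tensor vanishes, contraction with `y` gives `N̄ = N`, hence `δ̄ = δ`, and `δₖL̄ =
0` becomes `f₁ (∂ₖσ) A + f₂ b_{j|k}yʲ = 0` (`delta_change`). For (a) the second term is zero. Since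
`∂ₖσ` depends on `x` alone, one direction with `f₁ ≠ 0` suffices; it exists because otherwise `∂̇ⱼĒ`
would be proportional to `bⱼ` on the fibre and `ḡ` would have rank at most one, which is impossible
for `n ≥ 2`.

For (i) ⇒ (ii) with `dσ = 0`, both `A` and `β` are horizontally constant, so `δₖĒ = 0`. This forces
the sprays to agree (`spray_eq_of_delta_energy`), hence `N̄ = N`. Moreover `ḡ` is assembled from
parallel objects, so `Γ` is symmetric and metrical for `ḡ`, and uniqueness gives `Γ̄ = Γ`
(`cartan_eq`).

For (ii) ⇒ (i), at a point with `f₂ ≠ 0` the displayed equation gives `δₖβ = 0`; then in `∂̇ⱼL̄ = f₁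
e^σ ∂̇ⱼL + f₂ bⱼ` everything except `bⱼ` is known to be parallel, so `bⱼ` is too
(`hCovDeriv_eq_zero`). Continuity and the effectiveness hypothesis extend this to points where `f₂ =
0`. -/

namespace Finsler

variable {n : ℕ}

/-! ### Calculus of scalars `F x y` on an open set of the coordinate tangent bundle -/

/-- `F` is smooth as a function of the pair `(x, y)` on `Ω`. -/
def SmoothOn (Ω : Set (Coord n × Coord n)) (F : Coord n → Coord n → ℝ) : Prop :=
  ContDiffOn ℝ ∞ (fun p : Coord n × Coord n => F p.1 p.2) Ω

/-- The functional `T` is the derivative at `(x, y)` in some fixed direction. -/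
def IsTangentDeriv (T : (Coord n → Coord n → ℝ) → ℝ) (x y : Coord n) : Prop :=
  ∃ w : Coord n × Coord n, ∀ F : Coord n → Coord n → ℝ,
    DifferentiableAt ℝ (fun p : Coord n × Coord n => F p.1 p.2) (x, y) →
      T F = fderiv ℝ (fun p : Coord n × Coord n => F p.1 p.2) (x, y) w

/-! ### Smooth scalars, their partial derivatives, and the symmetry of second derivatives -/

section Smooth

variable {Ω : Set (Coord n × Coord n)} {F G : Coord n → Coord n → ℝ} {x y : Coord n}

theorem SmoothOn.contDiffAt (hF : SmoothOn Ω F) (hΩ : IsOpen Ω) (h : (x, y) ∈ Ω) :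
    ContDiffAt ℝ ∞ (fun p : Coord n × Coord n => F p.1 p.2) (x, y) :=
  ContDiffOn.contDiffAt hF (hΩ.mem_nhds h)

theorem SmoothOn.differentiableAt (hF : SmoothOn Ω F) (hΩ : IsOpen Ω) (h : (x, y) ∈ Ω) :
    DifferentiableAt ℝ (fun p : Coord n × Coord n => F p.1 p.2) (x, y) :=
  (hF.contDiffAt hΩ h).differentiableAt (by simp)

theorem SmoothOn.add (hF : SmoothOn Ω F) (hG : SmoothOn Ω G) :
    SmoothOn Ω (fun u v => F u v + G u v) := ContDiffOn.add hF hG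

theorem SmoothOn.sub (hF : SmoothOn Ω F) (hG : SmoothOn Ω G) :
    SmoothOn Ω (fun u v => F u v - G u v) := ContDiffOn.sub hF hG

theorem SmoothOn.mul (hF : SmoothOn Ω F) (hG : SmoothOn Ω G) :
    SmoothOn Ω (fun u v => F u v * G u v) := ContDiffOn.mul hF hG

theorem SmoothOn.pow (hF : SmoothOn Ω F) (m : ℕ) :
    SmoothOn Ω (fun u v => F u v ^ m) := ContDiffOn.pow hF m

theorem SmoothOn.inv (hF : SmoothOn Ω F) (h : ∀ u v, (u, v) ∈ Ω → F u v ≠ 0) :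
    SmoothOn Ω (fun u v => (F u v)⁻¹) := ContDiffOn.inv hF fun p hp => h p.1 p.2 hp

theorem SmoothOn.const (c : ℝ) : SmoothOn Ω (fun _ _ => c) := contDiffOn_const

theorem SmoothOn.sum {ι : Type*} {s : Finset ι} {F : ι → Coord n → Coord n → ℝ}
    (hF : ∀ i ∈ s, SmoothOn Ω (F i)) : SmoothOn Ω (fun u v => ∑ i ∈ s, F i u v) :=
  ContDiffOn.sum hF

theorem SmoothOn.prod {ι : Type*} {s : Finset ι} {F : ι → Coord n → Coord n → ℝ}
    (hF : ∀ i ∈ s, SmoothOn Ω (F i)) : SmoothOn Ω (fun u v => ∏ i ∈ s, F i u v) :=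
  contDiffOn_prod hF

theorem SmoothOn.fibreCoord (i : Fin n) : SmoothOn Ω (fun _ v => v i) := by
  have h : ContDiff ℝ ∞ (fun p : Coord n × Coord n => (EuclideanSpace.proj i : _ →L[ℝ] ℝ) p.2) :=
    (EuclideanSpace.proj i : Coord n →L[ℝ] ℝ).contDiff.comp contDiff_snd
  exact h.contDiffOn

theorem SmoothOn.comp₂ {H : ℝ × ℝ → ℝ} {U : Set (ℝ × ℝ)} (hH : ContDiffOn ℝ ∞ H U)
    (hF : SmoothOn Ω F) (hG : SmoothOn Ω G) (hU : ∀ u v, (u, v) ∈ Ω → (F u v, G u v) ∈ U) :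
    SmoothOn Ω (fun u v => H (F u v, G u v)) :=
  ContDiffOn.comp hH (ContDiffOn.prodMk hF hG) fun p hp => hU p.1 p.2 hp

theorem SmoothOn.congr (hF : SmoothOn Ω F) (h : ∀ u v, (u, v) ∈ Ω → G u v = F u v) :
    SmoothOn Ω G := ContDiffOn.congr hF fun p hp => h p.1 p.2 hp

theorem SmoothOn.continuousOn (hF : SmoothOn Ω F) :
    ContinuousOn (fun p : Coord n × Coord n => F p.1 p.2) Ω := ContDiffOn.continuousOn hF

theorem pdx_eq_fderiv (i : Fin n)
    (hF : DifferentiableAt ℝ (fun p : Coord n × Coord n => F p.1 p.2) (x, y)) :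
    pdx i F x y = fderiv ℝ (fun p : Coord n × Coord n => F p.1 p.2) (x, y)
      (EuclideanSpace.single i 1, 0) := by
  have h := HasFDerivAt.comp x (f := fun u : Coord n => (u, y)) hF.hasFDerivAt
    (hasFDerivAt_prodMk_left x y)
  rw [pdx, show (fun u => F u y) = (fun p : Coord n × Coord n => F p.1 p.2) ∘ fun u => (u, y)
    from rfl, h.fderiv]
  simp

theorem pdy_eq_fderiv (i : Fin n)
    (hF : DifferentiableAt ℝ (fun p : Coord n × Coord n => F p.1 p.2) (x, y)) :
    pdy i F x y = fderiv ℝ (fun p : Coord n × Coord n => F p.1 p.2) (x, y)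
      (0, EuclideanSpace.single i 1) := by
  have h := HasFDerivAt.comp y (f := fun v : Coord n => (x, v)) hF.hasFDerivAt
    (hasFDerivAt_prodMk_right x y)
  rw [pdy, show (fun v => F x v) = (fun p : Coord n × Coord n => F p.1 p.2) ∘ fun v => (x, v)
    from rfl, h.fderiv]
  simp

theorem SmoothOn.fderiv_apply (hF : SmoothOn Ω F) (hΩ : IsOpen Ω) (w : Coord n × Coord n) :
    ContDiffOn ℝ ∞ (fun q => fderiv ℝ (fun p : Coord n × Coord n => F p.1 p.2) q w) Ω :=
  (ContDiffOn.fderiv_of_isOpen hF hΩ (m := ∞) (by simp)).clm_apply contDiffOn_const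

theorem SmoothOn.pdx (hF : SmoothOn Ω F) (hΩ : IsOpen Ω) (i : Fin n) :
    SmoothOn Ω (pdx i F) :=
  (hF.fderiv_apply hΩ (EuclideanSpace.single i 1, 0)).congr fun _ hp =>
    pdx_eq_fderiv i (hF.differentiableAt hΩ hp)

theorem SmoothOn.pdy (hF : SmoothOn Ω F) (hΩ : IsOpen Ω) (i : Fin n) :
    SmoothOn Ω (pdy i F) :=
  (hF.fderiv_apply hΩ (0, EuclideanSpace.single i 1)).congr fun _ hp =>
    pdy_eq_fderiv i (hF.differentiableAt hΩ hp)

/-- Schwarz's theorem for arbitrary directions in the product space; the mixed (`∂`, `∂̇`) and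
vertical (`∂̇`, `∂̇`) cases are both specializations. -/
theorem SmoothOn.fderiv_fderiv_comm (hF : SmoothOn Ω F) (hΩ : IsOpen Ω) (h : (x, y) ∈ Ω)
    (w w' : Coord n × Coord n) :
    fderiv ℝ (fun q => fderiv ℝ (fun p : Coord n × Coord n => F p.1 p.2) q w) (x, y) w' =
      fderiv ℝ (fun q => fderiv ℝ (fun p : Coord n × Coord n => F p.1 p.2) q w') (x, y) w := by
  have hd : DifferentiableAt ℝ (fderiv ℝ (fun p : Coord n × Coord n => F p.1 p.2)) (x, y) :=
    ((hF.contDiffAt hΩ h).fderiv_right (m := ∞) (by simp)).differentiableAt (by simp)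
  have hs := (hF.contDiffAt hΩ h).isSymmSndFDerivAt (by
    simpa using (WithTop.coe_le_coe.2 le_top : ((2 : ℕ∞) : WithTop ℕ∞) ≤ ∞))
  rw [fderiv_clm_apply hd (differentiableAt_const _), fderiv_clm_apply hd (differentiableAt_const _)]
  simpa using hs.eq w' w

theorem SmoothOn.pdx_pdy_comm (hF : SmoothOn Ω F) (hΩ : IsOpen Ω) (h : (x, y) ∈ Ω)
    (i j : Fin n) : Finsler.pdx i (Finsler.pdy j F) x y = Finsler.pdy j (Finsler.pdx i F) x y := by
  rw [pdx_eq_fderiv i ((hF.pdy hΩ j).differentiableAt hΩ h),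
    pdy_eq_fderiv j ((hF.pdx hΩ i).differentiableAt hΩ h)]
  have e₁ : (fun p : Coord n × Coord n => Finsler.pdy j F p.1 p.2) =ᶠ[nhds (x, y)]
      fun q => fderiv ℝ (fun p : Coord n × Coord n => F p.1 p.2) q
        (0, EuclideanSpace.single j 1) := by
    filter_upwards [hΩ.mem_nhds h] with p hp using pdy_eq_fderiv j (hF.differentiableAt hΩ hp)
  have e₂ : (fun p : Coord n × Coord n => Finsler.pdx i F p.1 p.2) =ᶠ[nhds (x, y)]
      fun q => fderiv ℝ (fun p : Coord n × Coord n => F p.1 p.2) q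
        (EuclideanSpace.single i 1, 0) := by
    filter_upwards [hΩ.mem_nhds h] with p hp using pdx_eq_fderiv i (hF.differentiableAt hΩ hp)
  rw [e₁.fderiv_eq, e₂.fderiv_eq, hF.fderiv_fderiv_comm hΩ h]

theorem SmoothOn.pdy_pdy_comm (hF : SmoothOn Ω F) (hΩ : IsOpen Ω) (h : (x, y) ∈ Ω)
    (i j : Fin n) : Finsler.pdy i (Finsler.pdy j F) x y = Finsler.pdy j (Finsler.pdy i F) x y := by
  rw [pdy_eq_fderiv i ((hF.pdy hΩ j).differentiableAt hΩ h),
    pdy_eq_fderiv j ((hF.pdy hΩ i).differentiableAt hΩ h)]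
  have e (j : Fin n) : (fun p : Coord n × Coord n => Finsler.pdy j F p.1 p.2) =ᶠ[nhds (x, y)]
      fun q => fderiv ℝ (fun p : Coord n × Coord n => F p.1 p.2) q
        (0, EuclideanSpace.single j 1) := by
    filter_upwards [hΩ.mem_nhds h] with p hp using pdy_eq_fderiv j (hF.differentiableAt hΩ hp)
  rw [(e i).fderiv_eq, (e j).fderiv_eq, hF.fderiv_fderiv_comm hΩ h]

end Smooth

/-! ### Derivation rules shared by `∂ᵢ`, `∂̇ᵢ` and `δᵢ` -/

section TangentDeriv

variable {Ω : Set (Coord n × Coord n)} {F G : Coord n → Coord n → ℝ} {x y : Coord n}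
  {T : (Coord n → Coord n → ℝ) → ℝ}

theorem isTangentDeriv_pdx (i : Fin n) (x y : Coord n) :
    IsTangentDeriv (fun F => pdx i F x y) x y :=
  ⟨(EuclideanSpace.single i 1, 0), fun _ hF => pdx_eq_fderiv i hF⟩

theorem isTangentDeriv_pdy (i : Fin n) (x y : Coord n) :
    IsTangentDeriv (fun F => pdy i F x y) x y :=
  ⟨(0, EuclideanSpace.single i 1), fun _ hF => pdy_eq_fderiv i hF⟩

theorem isTangentDeriv_delta (L : Coord n → Coord n → ℝ) (k : Fin n) (x y : Coord n) :
    IsTangentDeriv (fun F => delta L k F x y) x y := by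
  refine ⟨(EuclideanSpace.single k 1, 0) -
    ∑ r, barthel L r k x y • ((0 : Coord n), EuclideanSpace.single r (1 : ℝ)), fun F hF => ?_⟩
  simp only [delta, map_sub, map_sum, map_smul, smul_eq_mul, pdx_eq_fderiv k hF,
    pdy_eq_fderiv _ hF]

namespace IsTangentDeriv

theorem add (hT : IsTangentDeriv T x y) (hΩ : IsOpen Ω) (h : (x, y) ∈ Ω) (hF : SmoothOn Ω F)
    (hG : SmoothOn Ω G) : T (fun u v => F u v + G u v) = T F + T G := by
  obtain ⟨w, hw⟩ := hT
  have h₁ := hF.differentiableAt hΩ h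
  have h₂ := hG.differentiableAt hΩ h
  rw [hw _ h₁, hw _ h₂, hw _ (h₁.add h₂), fderiv_fun_add h₁ h₂]
  rfl

theorem sub (hT : IsTangentDeriv T x y) (hΩ : IsOpen Ω) (h : (x, y) ∈ Ω) (hF : SmoothOn Ω F)
    (hG : SmoothOn Ω G) : T (fun u v => F u v - G u v) = T F - T G := by
  obtain ⟨w, hw⟩ := hT
  have h₁ := hF.differentiableAt hΩ h
  have h₂ := hG.differentiableAt hΩ h
  rw [hw _ h₁, hw _ h₂, hw _ (h₁.sub h₂), fderiv_fun_sub h₁ h₂]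
  rfl

theorem mul (hT : IsTangentDeriv T x y) (hΩ : IsOpen Ω) (h : (x, y) ∈ Ω) (hF : SmoothOn Ω F)
    (hG : SmoothOn Ω G) : T (fun u v => F u v * G u v) = T F * G x y + F x y * T G := by
  obtain ⟨w, hw⟩ := hT
  have h₁ := hF.differentiableAt hΩ h
  have h₂ := hG.differentiableAt hΩ h
  rw [hw _ h₁, hw _ h₂, hw _ (h₁.mul h₂), fderiv_fun_mul h₁ h₂]
  simp only [add_apply, smul_apply, smul_eq_mul]
  ring

theorem const (hT : IsTangentDeriv T x y) (c : ℝ) : T (fun _ _ => c) = 0 := by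
  obtain ⟨w, hw⟩ := hT
  rw [hw _ (differentiableAt_const _)]
  simp

theorem const_mul (hT : IsTangentDeriv T x y) (hΩ : IsOpen Ω) (h : (x, y) ∈ Ω)
    (hF : SmoothOn Ω F) (c : ℝ) : T (fun u v => c * F u v) = c * T F := by
  rw [hT.mul hΩ h (SmoothOn.const c) hF, hT.const]
  ring

theorem sum (hT : IsTangentDeriv T x y) (hΩ : IsOpen Ω) (h : (x, y) ∈ Ω) {ι : Type*}
    {s : Finset ι} {F : ι → Coord n → Coord n → ℝ} (hF : ∀ i ∈ s, SmoothOn Ω (F i)) :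
    T (fun u v => ∑ i ∈ s, F i u v) = ∑ i ∈ s, T (F i) := by
  obtain ⟨w, hw⟩ := hT
  have h₁ := fun i hi => (hF i hi).differentiableAt hΩ h
  rw [hw _ ((SmoothOn.sum hF).differentiableAt hΩ h), fderiv_fun_sum h₁, sum_apply]
  exact Finset.sum_congr rfl fun i hi => (hw _ (h₁ i hi)).symm

/-- Derivatives are local and `Ω` is open. This is the device by which an identity known throughout
`Ω` gets differentiated. -/
theorem congr (hT : IsTangentDeriv T x y) (hΩ : IsOpen Ω) (h : (x, y) ∈ Ω) (hF : SmoothOn Ω F)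
    (hFG : ∀ u v, (u, v) ∈ Ω → F u v = G u v) : T F = T G := by
  obtain ⟨w, hw⟩ := hT
  have hG : SmoothOn Ω G := hF.congr fun u v huv => (hFG u v huv).symm
  rw [hw _ (hF.differentiableAt hΩ h), hw _ (hG.differentiableAt hΩ h)]
  have e : (fun p : Coord n × Coord n => F p.1 p.2) =ᶠ[nhds (x, y)] fun p => G p.1 p.2 := by
    filter_upwards [hΩ.mem_nhds h] with p hp using hFG p.1 p.2 hp
  rw [e.fderiv_eq]

theorem comp₂ (hT : IsTangentDeriv T x y) (hΩ : IsOpen Ω) (h : (x, y) ∈ Ω) (hF : SmoothOn Ω F)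
    (hG : SmoothOn Ω G) {H : ℝ × ℝ → ℝ} (hH : DifferentiableAt ℝ H (F x y, G x y)) :
    T (fun u v => H (F u v, G u v)) =
      fderiv ℝ H (F x y, G x y) (1, 0) * T F + fderiv ℝ H (F x y, G x y) (0, 1) * T G := by
  obtain ⟨w, hw⟩ := hT
  have h₁ := hF.differentiableAt hΩ h
  have h₂ := hG.differentiableAt hΩ h
  have h₃ := HasFDerivAt.comp (f := fun p : Coord n × Coord n => (F p.1 p.2, G p.1 p.2)) (x, y)
    hH.hasFDerivAt (h₁.hasFDerivAt.prodMk h₂.hasFDerivAt)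
  rw [hw _ h₁, hw _ h₂, hw _ h₃.differentiableAt]
  erw [h₃.fderiv]
  simp only [ContinuousLinearMap.comp_apply, ContinuousLinearMap.prod_apply]
  generalize fderiv ℝ (fun p : Coord n × Coord n => F p.1 p.2) (x, y) w = a
  generalize fderiv ℝ (fun p : Coord n × Coord n => G p.1 p.2) (x, y) w = c
  have : (a, c) = a • ((1 : ℝ), (0 : ℝ)) + c • ((0 : ℝ), (1 : ℝ)) := by simp
  rw [this, map_add, map_smul, map_smul, smul_eq_mul, smul_eq_mul]
  ring

end IsTangentDeriv

theorem pdx_fibreCoord (i j : Fin n) (x y : Coord n) : pdx i (fun _ v => v j) x y = 0 := by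
  simp [pdx]

theorem pdy_fibreCoord (i j : Fin n) (x y : Coord n) :
    pdy i (fun _ v => v j) x y = if j = i then 1 else 0 := by
  have : fderiv ℝ (fun v : Coord n => v j) y = EuclideanSpace.proj j :=
    (EuclideanSpace.proj j : Coord n →L[ℝ] ℝ).fderiv
  rw [pdy, this]
  simp

theorem delta_fibreCoord (L : Coord n → Coord n → ℝ) (k j : Fin n) (x y : Coord n) :
    delta L k (fun _ v => v j) x y = -barthel L j k x y := by
  simp [delta, pdx_fibreCoord, pdy_fibreCoord]

theorem pdy_base (i : Fin n) (c : Coord n → ℝ) (x y : Coord n) :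
    pdy i (fun u _ => c u) x y = 0 := by
  simp [pdy]

theorem delta_base (L : Coord n → Coord n → ℝ) (k : Fin n) (c : Coord n → ℝ) (x y : Coord n) :
    delta L k (fun u _ => c u) x y = pdx k (fun u _ => c u) x y := by
  simp [delta, pdy_base]

end TangentDeriv

/-! ### Positive homogeneity and Euler's relation -/

section Homogeneous

variable {Ω : Set (Coord n × Coord n)} {F G : Coord n → Coord n → ℝ} {x y : Coord n}

/-- `F` is positively homogeneous of degree `m` in the fibre variable. -/
def HomogeneousOn (Ω : Set (Coord n × Coord n)) (m : ℕ) (F : Coord n → Coord n → ℝ) : Prop :=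
  ∀ x y, (x, y) ∈ Ω → ∀ t : ℝ, 0 < t → F x (t • y) = t ^ m * F x y

theorem HomogeneousOn.pdx {m : ℕ} (hF : HomogeneousOn Ω m F) (hΩ : IsOpen Ω)
    (hs : SmoothOn Ω F) (i : Fin n) : HomogeneousOn Ω m (pdx i F) := by
  intro x y h t ht
  have e : (fun u => F u (t • y)) =ᶠ[nhds x] fun u => t ^ m * F u y := by
    have : Filter.Tendsto (fun u : Coord n => (u, y)) (nhds x) (nhds (x, y)) := by
      exact (Continuous.prodMk_left y).tendsto x
    filter_upwards [this.eventually (hΩ.mem_nhds h)] with u hu using hF u y hu t ht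
  have hd : DifferentiableAt ℝ (fun u => F u y) x :=
    (hs.differentiableAt hΩ h).comp x (f := fun u : Coord n => (u, y)) (by fun_prop)
  rw [Finsler.pdx, Finsler.pdx, e.fderiv_eq, fderiv_const_mul hd]
  simp

/-- Differentiating `F(x, ty) = tᵐ⁺¹ F(x, y)` in `y` produces a factor `t` on the left, which is
cancelled. -/
theorem HomogeneousOn.pdy {m : ℕ} (hF : HomogeneousOn Ω (m + 1) F) (hΩ : IsOpen Ω)
    (hcone : ∀ x y, (x, y) ∈ Ω → ∀ t : ℝ, 0 < t → (x, t • y) ∈ Ω)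
    (hs : SmoothOn Ω F) (i : Fin n) : HomogeneousOn Ω m (pdy i F) := by
  intro x y h t ht
  have e : (fun v => F x (t • v)) =ᶠ[nhds y] fun v => t ^ (m + 1) * F x v := by
    have : Filter.Tendsto (fun v : Coord n => (x, v)) (nhds y) (nhds (x, y)) := by
      exact (Continuous.prodMk_right x).tendsto y
    filter_upwards [this.eventually (hΩ.mem_nhds h)] with v hv using hF x v hv t ht
  have hd : DifferentiableAt ℝ (fun v => F x v) y :=
    (hs.differentiableAt hΩ h).comp y (f := fun v : Coord n => (x, v)) (by fun_prop)
  have hd' : DifferentiableAt ℝ (fun v => F x v) (t • y) :=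
    (hs.differentiableAt hΩ (hcone x y h t ht)).comp (t • y) (f := fun v : Coord n => (x, v))
      (by fun_prop)
  have hl : HasFDerivAt (fun v : Coord n => t • v) (t • ContinuousLinearMap.id ℝ (Coord n)) y :=
    (t • ContinuousLinearMap.id ℝ (Coord n)).hasFDerivAt
  have h₁ : HasFDerivAt (fun v => F x (t • v)) ((fderiv ℝ (fun v => F x v) (t • y)).comp
      (t • ContinuousLinearMap.id ℝ (Coord n))) y :=
    HasFDerivAt.comp (g := fun v => F x v) (f := fun v : Coord n => t • v) y hd'.hasFDerivAt hl
  have h₂ := e.fderiv_eq (𝕜 := ℝ)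
  rw [fderiv_const_mul hd] at h₂
  have h₃ : fderiv ℝ (fun v => F x (t • v)) y (EuclideanSpace.single i 1) =
      t * Finsler.pdy i F x (t • y) := by
    rw [h₁.fderiv]
    simp [Finsler.pdy]
  rw [h₂] at h₃
  simp only [smul_apply, smul_eq_mul] at h₃
  refine mul_left_cancel₀ ht.ne' ?_
  rw [← h₃, Finsler.pdy]
  ring

theorem sum_smul_single (y : Coord n) : ∑ i, y i • EuclideanSpace.single i (1 : ℝ) = y := by
  ext j
  simp [Finset.sum_apply, Pi.single_apply]

/-- The curve `t ↦ F(x, ty)` is differentiated at `t = 1` in two ways: by the chain rule and as `tᵐ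
F(x, y)`. -/
theorem HomogeneousOn.euler {m : ℕ} (hF : HomogeneousOn Ω m F) (hΩ : IsOpen Ω)
    (hs : SmoothOn Ω F) (h : (x, y) ∈ Ω) : ∑ i, y i * Finsler.pdy i F x y = m * F x y := by
  have hd : DifferentiableAt ℝ (fun v => F x v) y :=
    (hs.differentiableAt hΩ h).comp y (f := fun v : Coord n => (x, v)) (by fun_prop)
  have h₀ : ∑ i, y i * Finsler.pdy i F x y = fderiv ℝ (fun v => F x v) y y := by
    have := congrArg (fderiv ℝ (fun v => F x v) y) (sum_smul_single y)
    simpa [Finsler.pdy] using this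
  have h₁ : HasDerivAt (fun t : ℝ => F x (t • y)) (fderiv ℝ (fun v => F x v) y y) 1 := by
    have hl : HasDerivAt (fun t : ℝ => t • y) y 1 := by
      simpa using (hasDerivAt_id (1 : ℝ)).smul_const y
    have hd' : HasFDerivAt (fun v => F x v) (fderiv ℝ (fun v => F x v) y) ((1 : ℝ) • y) := by
      simpa using hd.hasFDerivAt
    exact hd'.comp_hasDerivAt (1 : ℝ) hl
  have h₂ : HasDerivAt (fun t : ℝ => F x (t • y)) (m * F x y) 1 := by
    have : HasDerivAt (fun t : ℝ => t ^ m * F x y) (m * F x y) 1 := by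
      simpa using (hasDerivAt_pow m (1 : ℝ)).mul_const (F x y)
    refine this.congr_of_eventuallyEq ?_
    filter_upwards [lt_mem_nhds (zero_lt_one' ℝ)] with t ht using hF x y h t ht
  rw [h₀, h₁.unique h₂]

end Homogeneous

end Finsler

namespace Finsler

variable {n : ℕ}

/-! ### Local Finsler geometry -/

/-- `L` is a Finsler function on the open conic set `Ω` of the coordinate tangent bundle. -/
structure IsLocalFinsler (Ω : Set (Coord n × Coord n)) (L : Coord n → Coord n → ℝ) : Prop where
  isOpen : IsOpen Ω
  cone : ∀ x y, (x, y) ∈ Ω → ∀ t : ℝ, 0 < t → (x, t • y) ∈ Ω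
  smooth : SmoothOn Ω L
  pos : ∀ x y, (x, y) ∈ Ω → 0 < L x y
  homogeneous : HomogeneousOn Ω 1 L
  nondegenerate : ∀ x y, (x, y) ∈ Ω → (metric L x y).det ≠ 0

/-- The square `L²`. -/
def energy (L : Coord n → Coord n → ℝ) : Coord n → Coord n → ℝ := fun u v => L u v ^ 2

theorem metric_apply (L : Coord n → Coord n → ℝ) (x y : Coord n) (i j : Fin n) :
    metric L x y i j = (1 / 2) * pdy i (pdy j (energy L)) x y := rfl

theorem smoothOn_det {Ω : Set (Coord n × Coord n)}
    {A : Coord n → Coord n → Matrix (Fin n) (Fin n) ℝ}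
    (hA : ∀ i j, SmoothOn Ω (fun u v => A u v i j)) : SmoothOn Ω (fun u v => (A u v).det) := by
  simp only [Matrix.det_apply']
  exact SmoothOn.sum fun s _ => (SmoothOn.const _).mul (SmoothOn.prod fun i _ => hA _ _)

theorem smoothOn_matrix_inv {Ω : Set (Coord n × Coord n)}
    {A : Coord n → Coord n → Matrix (Fin n) (Fin n) ℝ}
    (hA : ∀ i j, SmoothOn Ω (fun u v => A u v i j)) (hdet : ∀ u v, (u, v) ∈ Ω → (A u v).det ≠ 0)
    (i j : Fin n) : SmoothOn Ω (fun u v => (A u v)⁻¹ i j) := by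
  have hadj : SmoothOn Ω (fun u v => (A u v).adjugate i j) := by
    -- Cramer's rule: each entry of the adjugate is the determinant of the matrix with one row
    -- replaced by a constant unit vector.
    simp only [Matrix.adjugate_apply]
    refine smoothOn_det fun k l => ?_
    by_cases hk : k = j
    · subst hk
      simpa using SmoothOn.const _
    · simpa [Matrix.updateRow_ne hk] using hA k l
  have : (fun u v => (A u v)⁻¹ i j) = fun u v => ((A u v).det)⁻¹ * (A u v).adjugate i j := by
    funext u v
    simp [Matrix.inv_def]
  rw [this]
  exact ((smoothOn_det hA).inv hdet).mul hadj

namespace IsLocalFinsler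

variable {Ω : Set (Coord n × Coord n)} {L : Coord n → Coord n → ℝ} {x y : Coord n}

theorem smooth_energy (H : IsLocalFinsler Ω L) : SmoothOn Ω (energy L) := H.smooth.pow 2

theorem smooth_pdy_energy (H : IsLocalFinsler Ω L) (i : Fin n) : SmoothOn Ω (pdy i (energy L)) :=
  H.smooth_energy.pdy H.isOpen i

theorem smooth_hessian (H : IsLocalFinsler Ω L) (i j : Fin n) :
    SmoothOn Ω (pdy i (pdy j (energy L))) :=
  (H.smooth_pdy_energy j).pdy H.isOpen i

theorem smooth_metric (H : IsLocalFinsler Ω L) (i j : Fin n) :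
    SmoothOn Ω (fun u v => metric L u v i j) :=
  (SmoothOn.const _).mul (H.smooth_hessian i j)

theorem smooth_metricInv (H : IsLocalFinsler Ω L) (i j : Fin n) :
    SmoothOn Ω (fun u v => metricInv L u v i j) :=
  smoothOn_matrix_inv H.smooth_metric H.nondegenerate i j

theorem smooth_christoffel (H : IsLocalFinsler Ω L) (i j k : Fin n) :
    SmoothOn Ω (christoffel L i j k) :=
  (SmoothOn.const _).mul (SmoothOn.sum fun r _ => (H.smooth_metricInv i r).mul
    ((((H.smooth_metric k r).pdx H.isOpen j).add ((H.smooth_metric j r).pdx H.isOpen k)).sub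
      ((H.smooth_metric j k).pdx H.isOpen r)))

theorem smooth_spray (H : IsLocalFinsler Ω L) (h : Fin n) : SmoothOn Ω (spray L h) :=
  (SmoothOn.const _).mul (SmoothOn.sum fun i _ => SmoothOn.sum fun j _ =>
    ((H.smooth_christoffel h i j).mul (SmoothOn.fibreCoord i)).mul (SmoothOn.fibreCoord j))

theorem smooth_barthel (H : IsLocalFinsler Ω L) (i j : Fin n) : SmoothOn Ω (barthel L i j) :=
  (H.smooth_spray i).pdy H.isOpen j

theorem smooth_delta (H : IsLocalFinsler Ω L) (k : Fin n) {F : Coord n → Coord n → ℝ}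
    (hF : SmoothOn Ω F) : SmoothOn Ω (delta L k F) :=
  (hF.pdx H.isOpen k).sub (SmoothOn.sum fun r _ => (H.smooth_barthel r k).mul
    (hF.pdy H.isOpen r))

theorem smooth_cartan (H : IsLocalFinsler Ω L) (i j k : Fin n) : SmoothOn Ω (cartan L i j k) :=
  (SmoothOn.const _).mul (SmoothOn.sum fun r _ => (H.smooth_metricInv i r).mul
    (((H.smooth_delta j (H.smooth_metric k r)).add (H.smooth_delta k (H.smooth_metric j r))).sub
      (H.smooth_delta r (H.smooth_metric j k))))

theorem hessian_symm (H : IsLocalFinsler Ω L) (h : (x, y) ∈ Ω) (i j : Fin n) :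
    pdy i (pdy j (energy L)) x y = pdy j (pdy i (energy L)) x y :=
  H.smooth_energy.pdy_pdy_comm H.isOpen h i j

theorem metric_symm (H : IsLocalFinsler Ω L) (h : (x, y) ∈ Ω) (i j : Fin n) :
    metric L x y i j = metric L x y j i := by
  rw [metric_apply, metric_apply, H.hessian_symm h]

/-! #### Homogeneity -/

theorem homogeneous_energy (H : IsLocalFinsler Ω L) : HomogeneousOn Ω 2 (energy L) := by
  intro x y h t ht
  simp only [energy, H.homogeneous x y h t ht]
  ring

theorem homogeneous_pdy_energy (H : IsLocalFinsler Ω L) (i : Fin n) :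
    HomogeneousOn Ω 1 (pdy i (energy L)) :=
  H.homogeneous_energy.pdy H.isOpen H.cone H.smooth_energy i

theorem homogeneous_metric (H : IsLocalFinsler Ω L) (i j : Fin n) :
    HomogeneousOn Ω 0 (fun u v => metric L u v i j) := by
  intro x y h t ht
  have := (H.homogeneous_pdy_energy j).pdy H.isOpen H.cone (H.smooth_pdy_energy j) i x y h t ht
  simp only [metric_apply, this]
  ring

theorem homogeneous_christoffel (H : IsLocalFinsler Ω L) (i j k : Fin n) :
    HomogeneousOn Ω 0 (christoffel L i j k) := by
  intro x y h t ht
  have hm : metric L x (t • y) = metric L x y := by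
    ext i j
    simpa using H.homogeneous_metric i j x y h t ht
  have hx (i j k : Fin n) : pdx k (fun u v => metric L u v i j) x (t • y) =
      pdx k (fun u v => metric L u v i j) x y := by
    simpa using (H.homogeneous_metric i j).pdx H.isOpen (H.smooth_metric i j) k x y h t ht
  simp only [christoffel, metricInv, hm, hx, pow_zero, one_mul]

theorem homogeneous_spray (H : IsLocalFinsler Ω L) (i : Fin n) :
    HomogeneousOn Ω 2 (spray L i) := by
  intro x y h t ht
  have hc (j k : Fin n) : christoffel L i j k x (t • y) = christoffel L i j k x y := by
    simpa using H.homogeneous_christoffel i j k x y h t ht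
  simp only [spray, hc, PiLp.smul_apply, smul_eq_mul, Finset.mul_sum]
  refine Finset.sum_congr rfl fun j _ => Finset.sum_congr rfl fun k _ => ?_
  ring

theorem euler_spray (H : IsLocalFinsler Ω L) (h : (x, y) ∈ Ω) (i : Fin n) :
    ∑ j, y j * barthel L i j x y = 2 * spray L i x y := by
  simpa [barthel] using (H.homogeneous_spray i).euler H.isOpen (H.smooth_spray i) h

theorem euler_energy (H : IsLocalFinsler Ω L) (h : (x, y) ∈ Ω) :
    ∑ j, y j * pdy j (energy L) x y = 2 * energy L x y := by
  simpa using H.homogeneous_energy.euler H.isOpen H.smooth_energy h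

theorem euler_pdy_energy (H : IsLocalFinsler Ω L) (h : (x, y) ∈ Ω) (i : Fin n) :
    ∑ j, y j * pdy j (pdy i (energy L)) x y = pdy i (energy L) x y := by
  simpa using (H.homogeneous_pdy_energy i).euler H.isOpen (H.smooth_pdy_energy i) h

theorem pdx_euler_energy (H : IsLocalFinsler Ω L) (h : (x, y) ∈ Ω) (k : Fin n) :
    ∑ j, y j * pdx k (pdy j (energy L)) x y = 2 * pdx k (energy L) x y := by
  have hT := isTangentDeriv_pdx k x y
  have h₁ := hT.congr H.isOpen h
    (SmoothOn.sum (s := Finset.univ)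
      fun j _ => (SmoothOn.fibreCoord j).mul (H.smooth_pdy_energy j))
    (G := fun u v => 2 * energy L u v) fun u v huv => H.euler_energy huv
  rw [hT.const_mul H.isOpen h H.smooth_energy,
    hT.sum H.isOpen h fun j _ => (SmoothOn.fibreCoord j).mul (H.smooth_pdy_energy j)] at h₁
  rw [← h₁]
  refine Finset.sum_congr rfl fun j _ => ?_
  rw [hT.mul H.isOpen h (SmoothOn.fibreCoord j) (H.smooth_pdy_energy j), pdx_fibreCoord]
  ring

theorem pdx_euler_pdy_energy (H : IsLocalFinsler Ω L) (h : (x, y) ∈ Ω) (i k : Fin n) :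
    ∑ j, y j * pdx k (pdy j (pdy i (energy L))) x y = pdx k (pdy i (energy L)) x y := by
  have hT := isTangentDeriv_pdx k x y
  have h₁ := hT.congr H.isOpen h
    (SmoothOn.sum (s := Finset.univ)
      fun j _ => (SmoothOn.fibreCoord j).mul (H.smooth_hessian j i))
    (G := pdy i (energy L)) fun u v huv => H.euler_pdy_energy huv i
  rw [hT.sum H.isOpen h fun j _ => (SmoothOn.fibreCoord j).mul (H.smooth_hessian j i)] at h₁
  rw [← h₁]
  refine Finset.sum_congr rfl fun j _ => ?_
  rw [hT.mul H.isOpen h (SmoothOn.fibreCoord j) (H.smooth_hessian j i), pdx_fibreCoord]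
  ring

/-! #### The metric as an isomorphism -/

theorem metric_mul_metricInv (H : IsLocalFinsler Ω L) (h : (x, y) ∈ Ω) (w : Fin n → ℝ)
    (r : Fin n) : ∑ i, metric L x y r i * ∑ s, metricInv L x y i s * w s = w r := by
  have h₁ : metric L x y * metricInv L x y = 1 :=
    Matrix.mul_nonsing_inv _ (isUnit_iff_ne_zero.2 (H.nondegenerate x y h))
  have h₂ : Matrix.mulVec (metric L x y) (Matrix.mulVec (metricInv L x y) w) = w := by
    rw [Matrix.mulVec_mulVec, h₁, Matrix.one_mulVec]
  exact congrFun h₂ r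

theorem metric_injective (H : IsLocalFinsler Ω L) (h : (x, y) ∈ Ω) {a c : Fin n → ℝ}
    (hac : ∀ r, ∑ i, metric L x y r i * a i = ∑ i, metric L x y r i * c i) : a = c :=
  Matrix.mulVec_injective_iff_isUnit.2
    ((Matrix.isUnit_iff_isUnit_det _).2 (isUnit_iff_ne_zero.2 (H.nondegenerate x y h)))
    (funext hac)

theorem pdx_metric (H : IsLocalFinsler Ω L) (h : (x, y) ∈ Ω) (i j k : Fin n) :
    pdx k (fun u v => metric L u v i j) x y =
      (1 / 2) * pdx k (pdy i (pdy j (energy L))) x y :=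
  (isTangentDeriv_pdx k x y).const_mul H.isOpen h (H.smooth_hessian i j) _

theorem delta_metric (H : IsLocalFinsler Ω L) (h : (x, y) ∈ Ω) (L' : Coord n → Coord n → ℝ)
    (i j k : Fin n) : delta L' k (fun u v => metric L u v i j) x y =
      (1 / 2) * delta L' k (pdy i (pdy j (energy L))) x y :=
  (isTangentDeriv_delta L' k x y).const_mul H.isOpen h (H.smooth_hessian i j) _

theorem delta_metric_symm (H : IsLocalFinsler Ω L) (h : (x, y) ∈ Ω) (L' : Coord n → Coord n → ℝ)
    (i j k : Fin n) : delta L' k (fun u v => metric L u v i j) x y =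
      delta L' k (fun u v => metric L u v j i) x y :=
  (isTangentDeriv_delta L' k x y).congr H.isOpen h (H.smooth_metric i j)
    fun _ _ huv => H.metric_symm huv i j

/-! #### The canonical spray and the Barthel connection -/

/-- The Euler–Lagrange form of the spray, free of the inverse metric. After lowering the index,
Euler's relations for `∂̇ᵣE` make the first two Christoffel terms equal, and those for `∂̇ᵣE` and
`E` together reduce the third to `∂ᵣE`. -/
theorem metric_mul_spray (H : IsLocalFinsler Ω L) (h : (x, y) ∈ Ω) (r : Fin n) :
    4 * ∑ i, metric L x y r i * spray L i x y =
      ∑ j, y j * pdx j (pdy r (energy L)) x y - pdx r (energy L) x y := by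
  have hc (j k : Fin n) : ∑ i, metric L x y r i * christoffel L i j k x y =
      (1 / 2) * (pdx j (fun u v => metric L u v k r) x y +
        pdx k (fun u v => metric L u v j r) x y - pdx r (fun u v => metric L u v j k) x y) := by
    rw [← H.metric_mul_metricInv h (fun r => (1 / 2) * (pdx j (fun u v => metric L u v k r) x y +
        pdx k (fun u v => metric L u v j r) x y - pdx r (fun u v => metric L u v j k) x y)) r]
    refine Finset.sum_congr rfl fun i _ => ?_
    rw [christoffel, Finset.mul_sum]
    congr 1
    exact Finset.sum_congr rfl fun s _ => by ring
  have h₁ : ∑ i, metric L x y r i * spray L i x y = (1 / 2) * ∑ j, ∑ k,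
      (∑ i, metric L x y r i * christoffel L i j k x y) * y j * y k := by
    simp only [spray, Finset.mul_sum, Finset.sum_mul]
    rw [Finset.sum_comm]
    refine Finset.sum_congr rfl fun j _ => ?_
    rw [Finset.sum_comm]
    refine Finset.sum_congr rfl fun k _ => Finset.sum_congr rfl fun i _ => ?_
    ring
  have h₂ (j k : Fin n) : (∑ i, metric L x y r i * christoffel L i j k x y) * y j * y k =
      (1 / 4) * (y j * (y k * pdx j (pdy k (pdy r (energy L))) x y)) +
      (1 / 4) * (y k * (y j * pdx k (pdy j (pdy r (energy L))) x y)) -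
      (1 / 4) * (y k * (y j * pdx r (pdy j (pdy k (energy L))) x y)) := by
    rw [hc, H.pdx_metric h, H.pdx_metric h, H.pdx_metric h]
    ring
  have e₁ : ∑ j, ∑ k, (1 / 4) * (y j * (y k * pdx j (pdy k (pdy r (energy L))) x y)) =
      (1 / 4) * ∑ j, y j * pdx j (pdy r (energy L)) x y := by
    simp only [← Finset.mul_sum, H.pdx_euler_pdy_energy h]
  have e₂ : ∑ j, ∑ k, (1 / 4) * (y k * (y j * pdx k (pdy j (pdy r (energy L))) x y)) =
      (1 / 4) * ∑ j, y j * pdx j (pdy r (energy L)) x y := by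
    rw [Finset.sum_comm]
    simp only [← Finset.mul_sum, H.pdx_euler_pdy_energy h]
  have e₃ : ∑ j, ∑ k, (1 / 4) * (y k * (y j * pdx r (pdy j (pdy k (energy L))) x y)) =
      (1 / 2) * pdx r (energy L) x y := by
    rw [Finset.sum_comm]
    simp only [← Finset.mul_sum, H.pdx_euler_pdy_energy h, H.pdx_euler_energy h]
    ring
  rw [h₁]
  simp only [h₂, Finset.sum_sub_distrib, Finset.sum_add_distrib, e₁, e₂, e₃]
  ring

/-- Contraction of `metric_mul_spray` with `yʳ`, using `yʳgᵣᵢ = ½∂̇ᵢE`. It says that `E` is constant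
along the geodesic spray. -/
theorem pdy_energy_mul_spray (H : IsLocalFinsler Ω L) (h : (x, y) ∈ Ω) :
    2 * ∑ i, pdy i (energy L) x y * spray L i x y = ∑ j, y j * pdx j (energy L) x y := by
  have h₁ : ∑ r, y r * (4 * ∑ i, metric L x y r i * spray L i x y) =
      2 * ∑ i, pdy i (energy L) x y * spray L i x y := by
    simp only [Finset.mul_sum]
    rw [Finset.sum_comm]
    refine Finset.sum_congr rfl fun i _ => ?_
    rw [← H.euler_pdy_energy h i, Finset.sum_mul, Finset.mul_sum]
    refine Finset.sum_congr rfl fun r _ => ?_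
    rw [metric_apply]
    ring
  have h₂ : ∑ r, y r * ∑ j, y j * pdx j (pdy r (energy L)) x y =
      2 * ∑ j, y j * pdx j (energy L) x y := by
    simp only [Finset.mul_sum]
    rw [Finset.sum_comm]
    refine Finset.sum_congr rfl fun j _ => ?_
    rw [mul_left_comm, ← H.pdx_euler_energy h j, Finset.mul_sum]
    exact Finset.sum_congr rfl fun r _ => by ring
  rw [← h₁]
  simp only [H.metric_mul_spray h, mul_sub, Finset.sum_sub_distrib, h₂]
  ring

/-- Differentiating `pdy_energy_mul_spray` with respect to `yᵏ` produces `2Nⁱₖ∂̇ᵢE` and terms in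
`gₖᵢGⁱ`; eliminating the latter by `metric_mul_spray` leaves twice the claim. -/
theorem delta_energy (H : IsLocalFinsler Ω L) (h : (x, y) ∈ Ω) (k : Fin n) :
    delta L k (energy L) x y = 0 := by
  have hT := isTangentDeriv_pdy k x y
  have s₁ : ∀ i ∈ Finset.univ, SmoothOn Ω (fun u v => pdy i (energy L) u v * spray L i u v) :=
    fun i _ => (H.smooth_pdy_energy i).mul (H.smooth_spray i)
  have s₂ : ∀ j ∈ Finset.univ, SmoothOn Ω (fun u v => v j * pdx j (energy L) u v) :=
    fun j _ => (SmoothOn.fibreCoord j).mul (H.smooth_energy.pdx H.isOpen j)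
  have h₁ := hT.congr H.isOpen h ((SmoothOn.const 2).mul (SmoothOn.sum s₁))
    fun u v huv => H.pdy_energy_mul_spray huv
  rw [hT.const_mul H.isOpen h (SmoothOn.sum s₁), hT.sum H.isOpen h s₁, hT.sum H.isOpen h s₂] at h₁
  have h₂ (i : Fin n) : pdy k (fun u v => pdy i (energy L) u v * spray L i u v) x y =
      2 * (metric L x y k i * spray L i x y) + barthel L i k x y * pdy i (energy L) x y := by
    rw [hT.mul H.isOpen h (H.smooth_pdy_energy i) (H.smooth_spray i), metric_apply, barthel]
    ring
  have h₃ (j : Fin n) : pdy k (fun u v => v j * pdx j (energy L) u v) x y =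
      (if j = k then pdx j (energy L) x y else 0) + y j * pdx j (pdy k (energy L)) x y := by
    rw [hT.mul H.isOpen h (SmoothOn.fibreCoord j) (H.smooth_energy.pdx H.isOpen j),
      pdy_fibreCoord, H.smooth_energy.pdx_pdy_comm H.isOpen h]
    simp
  simp only [h₂, h₃, Finset.sum_add_distrib, ← Finset.mul_sum, Finset.sum_ite_eq',
    Finset.mem_univ, if_true] at h₁
  have h₄ := H.metric_mul_spray h k
  rw [delta]
  linarith

/-- Applying `∂̇ᵣ` to `∂ₖE = Nⁱₖ∂̇ᵢE` gives `δₖ∂̇ᵣE = (∂̇ᵣNⁱₖ)∂̇ᵢE`, and `∂̇ᵣNⁱₖ = ∂̇ᵣ∂̇ₖGⁱ` is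
symmetric in `k` and `r`. -/
theorem delta_pdy_energy_symm (H : IsLocalFinsler Ω L) (h : (x, y) ∈ Ω) (k r : Fin n) :
    delta L k (pdy r (energy L)) x y = delta L r (pdy k (energy L)) x y := by
  have key (k r : Fin n) : delta L k (pdy r (energy L)) x y =
      ∑ i, pdy r (barthel L i k) x y * pdy i (energy L) x y := by
    have hT := isTangentDeriv_pdy r x y
    have s₁ : ∀ i ∈ Finset.univ, SmoothOn Ω (fun u v => barthel L i k u v * pdy i (energy L) u v) :=
      fun i _ => (H.smooth_barthel i k).mul (H.smooth_pdy_energy i)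
    have h₁ := hT.congr H.isOpen h (H.smooth_energy.pdx H.isOpen k)
      (G := fun u v => ∑ i, barthel L i k u v * pdy i (energy L) u v)
      fun u v huv => sub_eq_zero.1 (H.delta_energy huv k)
    rw [hT.sum H.isOpen h s₁, ← H.smooth_energy.pdx_pdy_comm H.isOpen h] at h₁
    rw [delta, h₁, ← Finset.sum_sub_distrib]
    refine Finset.sum_congr rfl fun i _ => ?_
    rw [hT.mul H.isOpen h (H.smooth_barthel i k) (H.smooth_pdy_energy i), H.hessian_symm h i r]
    ring
  rw [key, key]
  refine Finset.sum_congr rfl fun i _ => ?_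
  rw [show pdy r (barthel L i k) x y = pdy r (pdy k (spray L i)) x y from rfl,
    (H.smooth_spray i).pdy_pdy_comm H.isOpen h]
  rfl

/-- Obtained by applying `∂̇ₖ` to `metric_mul_spray`. The relation `yʲNⁱⱼ = 2Gⁱ` turns `yʲ∂ⱼ` into
`yʲδⱼ`, and the leftover `∂ₖ∂̇ᵣE - ∂ᵣ∂̇ₖE` is expressed through `N` by `delta_pdy_energy_symm`. -/
theorem spray_delta_metric (H : IsLocalFinsler Ω L) (h : (x, y) ∈ Ω) (k r : Fin n) :
    ∑ j, y j * delta L j (fun u v => metric L u v k r) x y =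
      ∑ i, metric L x y r i * barthel L i k x y + ∑ i, metric L x y k i * barthel L i r x y := by
  have hT := isTangentDeriv_pdy k x y
  have s₁ : ∀ i ∈ Finset.univ, SmoothOn Ω (fun u v => metric L u v r i * spray L i u v) :=
    fun i _ => (H.smooth_metric r i).mul (H.smooth_spray i)
  have s₂ : ∀ j ∈ Finset.univ, SmoothOn Ω (fun u v => v j * pdx j (pdy r (energy L)) u v) :=
    fun j _ => (SmoothOn.fibreCoord j).mul ((H.smooth_pdy_energy r).pdx H.isOpen j)
  have h₁ := hT.congr H.isOpen h ((SmoothOn.const 4).mul (SmoothOn.sum s₁))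
    fun u v huv => H.metric_mul_spray huv r
  rw [hT.const_mul H.isOpen h (SmoothOn.sum s₁),
    hT.sub H.isOpen h (SmoothOn.sum s₂) (H.smooth_energy.pdx H.isOpen r),
    hT.sum H.isOpen h s₁, hT.sum H.isOpen h s₂] at h₁
  -- Total symmetry of the Cartan tensor: `∂̇ₖgᵣᵢ` is, up to a factor, a third vertical derivative
  -- of `E`.
  have hd (i : Fin n) : pdy k (fun u v => metric L u v r i) x y =
      pdy i (fun u v => metric L u v k r) x y := by
    have hT' := isTangentDeriv_pdy i x y
    rw [show (fun u v => metric L u v k r) = fun u v => (1 / 2) * pdy k (pdy r (energy L)) u v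
      from rfl, hT'.const_mul H.isOpen h (H.smooth_hessian k r),
      (H.smooth_pdy_energy r).pdy_pdy_comm H.isOpen h i k,
      ← hT.const_mul H.isOpen h (H.smooth_hessian i r)]
    exact hT.congr H.isOpen h (H.smooth_metric r i) fun u v huv => H.metric_symm huv r i
  have h₂ (i : Fin n) : pdy k (fun u v => metric L u v r i * spray L i u v) x y =
      pdy i (fun u v => metric L u v k r) x y * spray L i x y +
        metric L x y r i * barthel L i k x y := by
    rw [hT.mul H.isOpen h (H.smooth_metric r i) (H.smooth_spray i), hd]
    rfl
  have h₃ (j : Fin n) : pdy k (fun u v => v j * pdx j (pdy r (energy L)) u v) x y =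
      (if j = k then pdx j (pdy r (energy L)) x y else 0) +
        2 * (y j * pdx j (fun u v => metric L u v k r) x y) := by
    rw [hT.mul H.isOpen h (SmoothOn.fibreCoord j) ((H.smooth_pdy_energy r).pdx H.isOpen j),
      pdy_fibreCoord, ← (H.smooth_pdy_energy r).pdx_pdy_comm H.isOpen h, H.pdx_metric h]
    simp
    ring
  simp only [h₂, h₃, Finset.sum_add_distrib, ← Finset.mul_sum, Finset.sum_ite_eq',
    Finset.mem_univ, if_true, ← H.smooth_energy.pdx_pdy_comm H.isOpen h r k] at h₁
  have h₄ : ∑ j, y j * delta L j (fun u v => metric L u v k r) x y =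
      ∑ j, y j * pdx j (fun u v => metric L u v k r) x y -
        2 * ∑ i, pdy i (fun u v => metric L u v k r) x y * spray L i x y := by
    simp only [delta, mul_sub, Finset.sum_sub_distrib, Finset.mul_sum]
    rw [Finset.sum_comm]
    congr 1
    refine Finset.sum_congr rfl fun i _ => ?_
    rw [mul_left_comm, ← H.euler_spray h i, Finset.mul_sum]
    exact Finset.sum_congr rfl fun j _ => by ring
  have h₅ := H.delta_pdy_energy_symm h k r
  have h₆ (k r : Fin n) : delta L k (pdy r (energy L)) x y = pdx k (pdy r (energy L)) x y -
      2 * ∑ i, metric L x y r i * barthel L i k x y := by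
    rw [delta, Finset.mul_sum]
    congr 1
    refine Finset.sum_congr rfl fun i _ => ?_
    rw [H.metric_symm h r i, metric_apply]
    ring
  rw [h₆, h₆] at h₅
  linarith

/-! #### The Cartan connection -/

theorem metric_mul_cartan (H : IsLocalFinsler Ω L) (h : (x, y) ∈ Ω) (r j k : Fin n) :
    ∑ i, metric L x y r i * cartan L i j k x y =
      (1 / 2) * (delta L j (fun u v => metric L u v k r) x y +
        delta L k (fun u v => metric L u v j r) x y -
        delta L r (fun u v => metric L u v j k) x y) := by
  rw [← H.metric_mul_metricInv h (fun r => (1 / 2) *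
    (delta L j (fun u v => metric L u v k r) x y + delta L k (fun u v => metric L u v j r) x y -
      delta L r (fun u v => metric L u v j k) x y)) r]
  refine Finset.sum_congr rfl fun i _ => ?_
  rw [cartan, Finset.mul_sum]
  congr 1
  exact Finset.sum_congr rfl fun s _ => by ring

theorem cartan_symm (H : IsLocalFinsler Ω L) (h : (x, y) ∈ Ω) (i j k : Fin n) :
    cartan L i j k x y = cartan L i k j x y := by
  simp only [cartan]
  congr 1
  refine Finset.sum_congr rfl fun r _ => ?_
  rw [H.delta_metric_symm h L j k r]
  ring

/-- The Cartan connection is `h`-metrical. -/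
theorem delta_metric_eq (H : IsLocalFinsler Ω L) (h : (x, y) ∈ Ω) (i j k : Fin n) :
    delta L k (fun u v => metric L u v i j) x y =
      ∑ r, metric L x y r j * cartan L r i k x y + ∑ r, metric L x y i r * cartan L r j k x y := by
  have h₁ : ∑ r, metric L x y r j * cartan L r i k x y =
      ∑ r, metric L x y j r * cartan L r i k x y :=
    Finset.sum_congr rfl fun r _ => by rw [H.metric_symm h]
  -- In the sum of the two Christoffel combinations everything cancels except two copies of
  -- `½δₖgᵢⱼ`.
  rw [h₁, H.metric_mul_cartan h, H.metric_mul_cartan h, H.delta_metric_symm h L j i k,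
    H.delta_metric_symm h L k j i, H.delta_metric_symm h L k i j]
  ring

/-- The Cartan connection is the only symmetric `h`-metrical connection. -/
theorem eq_cartan (H : IsLocalFinsler Ω L) (h : (x, y) ∈ Ω) {C : Fin n → Fin n → Fin n → ℝ}
    (hsymm : ∀ i j k, C i j k = C i k j)
    (hC : ∀ i j k, delta L k (fun u v => metric L u v i j) x y =
      ∑ r, metric L x y r j * C r i k + ∑ r, metric L x y i r * C r j k) (i j k : Fin n) :
    C i j k = cartan L i j k x y := by
  refine congrFun (H.metric_injective h (a := fun i => C i j k)
    (c := fun i => cartan L i j k x y) fun r => ?_) i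
  -- The usual Christoffel elimination: the cyclic combination of the three metricity equations
  -- isolates `C` with its index lowered.
  simp only [H.metric_mul_cartan h, hC]
  have h₁ (r j k : Fin n) : ∑ i, metric L x y i r * C i j k = ∑ i, metric L x y r i * C i j k :=
    Finset.sum_congr rfl fun i _ => by rw [H.metric_symm h]
  simp only [h₁, hsymm _ k j, hsymm _ k r, hsymm _ j r]
  ring

/-- With the index lowered, one of the three terms of `yʲΓᵣⱼₖ` is given by `spray_delta_metric`. In
the other two, `δₖyʲ = -Nʲₖ` and Euler's relation leave `δₖ∂̇ᵣE - δᵣ∂̇ₖE`, which vanishes, and terms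
in `N`. This identity lets equality of Cartan connections imply equality of Barthel connections. -/
theorem cartan_mul_fibreCoord (H : IsLocalFinsler Ω L) (h : (x, y) ∈ Ω) (i k : Fin n) :
    ∑ j, cartan L i j k x y * y j = barthel L i k x y := by
  refine congrFun (H.metric_injective h (a := fun i => ∑ j, cartan L i j k x y * y j)
    (c := fun i => barthel L i k x y) fun r => ?_) i
  have hg (k r : Fin n) : ∑ j, y j * delta L k (fun u v => metric L u v j r) x y =
      (1 / 2) * delta L k (pdy r (energy L)) x y + ∑ j, metric L x y r j * barthel L j k x y := by
    have hT := isTangentDeriv_delta L k x y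
    have s : ∀ j ∈ Finset.univ, SmoothOn Ω (fun u v => v j * pdy j (pdy r (energy L)) u v) :=
      fun j _ => (SmoothOn.fibreCoord j).mul (H.smooth_hessian j r)
    have h₁ := hT.congr H.isOpen h (SmoothOn.sum s) fun u v huv => H.euler_pdy_energy huv r
    rw [hT.sum H.isOpen h s] at h₁
    rw [← h₁, Finset.mul_sum, ← Finset.sum_add_distrib]
    refine Finset.sum_congr rfl fun j _ => ?_
    rw [hT.mul H.isOpen h (SmoothOn.fibreCoord j) (H.smooth_hessian j r), delta_fibreCoord,
      H.delta_metric h, H.metric_symm h r j, metric_apply]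
    ring
  have h₁ : ∑ i, metric L x y r i * ∑ j, cartan L i j k x y * y j =
      ∑ j, y j * ∑ i, metric L x y r i * cartan L i j k x y := by
    simp only [Finset.mul_sum]
    rw [Finset.sum_comm]
    exact Finset.sum_congr rfl fun j _ => Finset.sum_congr rfl fun i _ => by ring
  have h₂ : ∑ j, y j * ∑ i, metric L x y r i * cartan L i j k x y = (1 / 2) *
      (∑ j, y j * delta L j (fun u v => metric L u v k r) x y +
        ∑ j, y j * delta L k (fun u v => metric L u v j r) x y -
        ∑ j, y j * delta L r (fun u v => metric L u v j k) x y) := by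
    rw [← Finset.sum_add_distrib, ← Finset.sum_sub_distrib, Finset.mul_sum]
    refine Finset.sum_congr rfl fun j _ => ?_
    rw [H.metric_mul_cartan h]
    ring
  rw [h₁, h₂, H.spray_delta_metric h, hg, hg, H.delta_pdy_energy_symm h k r]
  ring

/-- The `h`-covariant derivative of `∂̇ᵢ L²` vanishes. -/
theorem delta_pdy_energy (H : IsLocalFinsler Ω L) (h : (x, y) ∈ Ω) (i k : Fin n) :
    delta L k (pdy i (energy L)) x y = ∑ r, pdy r (energy L) x y * cartan L r i k x y := by
  have hT := isTangentDeriv_delta L k x y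
  have s : ∀ j ∈ Finset.univ, SmoothOn Ω (fun u v => v j * pdy j (pdy i (energy L)) u v) :=
    fun j _ => (SmoothOn.fibreCoord j).mul (H.smooth_hessian j i)
  have h₁ := hT.congr H.isOpen h (SmoothOn.sum s) fun u v huv => H.euler_pdy_energy huv i
  -- With `∂̇ᵢE = 2yʲgⱼᵢ`, metricity supplies the derivative of `g`; the term from `δₖyʲ = -Nʲₖ`
  -- cancels against `yʲΓʳⱼₖ = Nʳₖ`.
  rw [← h₁, hT.sum H.isOpen h s]
  have h₂ (j : Fin n) : delta L k (fun u v => v j * pdy j (pdy i (energy L)) u v) x y =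
      -(2 * (metric L x y j i * barthel L j k x y)) +
      2 * (y j * (∑ r, metric L x y r i * cartan L r j k x y +
        ∑ r, metric L x y j r * cartan L r i k x y)) := by
    rw [hT.mul H.isOpen h (SmoothOn.fibreCoord j) (H.smooth_hessian j i), delta_fibreCoord,
      ← H.delta_metric_eq h, H.delta_metric h, metric_apply]
    ring
  have h₃ : ∑ j, y j * ∑ r, metric L x y r i * cartan L r j k x y =
      ∑ r, metric L x y r i * barthel L r k x y := by
    simp only [← H.cartan_mul_fibreCoord h, Finset.mul_sum]
    rw [Finset.sum_comm]
    exact Finset.sum_congr rfl fun j _ => Finset.sum_congr rfl fun r _ => by ring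
  have h₄ : 2 * ∑ j, y j * ∑ r, metric L x y j r * cartan L r i k x y =
      ∑ r, pdy r (energy L) x y * cartan L r i k x y := by
    simp only [← H.euler_pdy_energy h, Finset.mul_sum, Finset.sum_mul]
    rw [Finset.sum_comm]
    refine Finset.sum_congr rfl fun j _ => Finset.sum_congr rfl fun r _ => ?_
    rw [metric_apply]
    ring
  simp only [h₂, mul_add, Finset.sum_add_distrib, Finset.sum_neg_distrib, ← Finset.mul_sum, h₃]
  linarith

end IsLocalFinsler

end Finsler

namespace Finsler

variable {n : ℕ}

theorem pdx_exp_base {Ω : Set (Coord n × Coord n)} {x y : Coord n} (hΩ : IsOpen Ω)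
    (h : (x, y) ∈ Ω) {s : Coord n → ℝ} (hs : SmoothOn Ω (fun u _ => s u)) (k : Fin n) :
    pdx k (fun u _ => Real.exp (s u)) x y = Real.exp (s x) * pdx k (fun u _ => s u) x y := by
  have hd : DifferentiableAt ℝ s x :=
    (hs.differentiableAt hΩ h).comp x (f := fun u : Coord n => (u, y)) (by fun_prop)
  simp [pdx, fderiv_exp hd]

theorem contDiffOn_fderiv_apply {U : Set (ℝ × ℝ)} (hU : IsOpen U) {f : ℝ × ℝ → ℝ}
    (hf : ContDiffOn ℝ ∞ f U) (w : ℝ × ℝ) : ContDiffOn ℝ ∞ (fun z => fderiv ℝ f z w) U :=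
  (ContDiffOn.fderiv_of_isOpen hf hU (m := ∞) (by simp)).clm_apply contDiffOn_const

/-! ### Scalars, covectors and tensors which are `h`-parallel at a point -/

section Parallel

/-- The scalar `F` is `h`-parallel in the direction `k` at `(x, y)`. -/
structure IsParallelScalar (Ω : Set (Coord n × Coord n)) (L : Coord n → Coord n → ℝ) (k : Fin n)
    (x y : Coord n) (F : Coord n → Coord n → ℝ) : Prop where
  smooth : SmoothOn Ω F
  delta_eq : delta L k F x y = 0

/-- The covector `w` is `h`-parallel in the direction `k` at `(x, y)`. -/
structure IsParallelCovector (Ω : Set (Coord n × Coord n)) (L : Coord n → Coord n → ℝ) (k : Fin n)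
    (x y : Coord n) (w : Fin n → Coord n → Coord n → ℝ) : Prop where
  smooth : ∀ i, SmoothOn Ω (w i)
  delta_eq : ∀ i, delta L k (w i) x y = ∑ r, w r x y * cartan L r i k x y

/-- The covariant tensor `T` is `h`-parallel in the direction `k` at `(x, y)`. -/
structure IsParallelTensor (Ω : Set (Coord n × Coord n)) (L : Coord n → Coord n → ℝ) (k : Fin n)
    (x y : Coord n) (T : Fin n → Fin n → Coord n → Coord n → ℝ) : Prop where
  smooth : ∀ i j, SmoothOn Ω (T i j)
  delta_eq : ∀ i j, delta L k (T i j) x y =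
    ∑ r, T r j x y * cartan L r i k x y + ∑ r, T i r x y * cartan L r j k x y

variable {Ω : Set (Coord n × Coord n)} {L : Coord n → Coord n → ℝ} {k : Fin n} {x y : Coord n}
  {F G : Coord n → Coord n → ℝ} {w w' : Fin n → Coord n → Coord n → ℝ}
  {T T' : Fin n → Fin n → Coord n → Coord n → ℝ}

theorem IsParallelScalar.comp₂ (hΩ : IsOpen Ω) (h : (x, y) ∈ Ω)
    (hF : IsParallelScalar Ω L k x y F) (hG : IsParallelScalar Ω L k x y G)
    {U : Set (ℝ × ℝ)} (hU : IsOpen U) {f : ℝ × ℝ → ℝ} (hf : ContDiffOn ℝ ∞ f U)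
    (hmaps : ∀ u v, (u, v) ∈ Ω → (F u v, G u v) ∈ U) :
    IsParallelScalar Ω L k x y (fun u v => f (F u v, G u v)) where
  smooth := SmoothOn.comp₂ hf hF.smooth hG.smooth hmaps
  delta_eq := by
    have hd : DifferentiableAt ℝ f (F x y, G x y) :=
      (hf.contDiffAt (hU.mem_nhds (hmaps x y h))).differentiableAt (by simp)
    rw [(isTangentDeriv_delta L k x y).comp₂ hΩ h hF.smooth hG.smooth hd, hF.delta_eq, hG.delta_eq]
    ring

theorem IsParallelScalar.inv (hΩ : IsOpen Ω) (h : (x, y) ∈ Ω)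
    (hF : IsParallelScalar Ω L k x y F) (h₀ : ∀ u v, (u, v) ∈ Ω → F u v ≠ 0) :
    IsParallelScalar Ω L k x y (fun u v => (F u v)⁻¹) where
  smooth := hF.smooth.inv h₀
  delta_eq := by
    have hT := isTangentDeriv_delta L k x y
    have h₁ := hT.congr hΩ h (hF.smooth.mul (hF.smooth.inv h₀)) (G := fun _ _ => 1)
      fun u v huv => mul_inv_cancel₀ (h₀ u v huv)
    rw [hT.mul hΩ h hF.smooth (hF.smooth.inv h₀), hF.delta_eq, hT.const] at h₁
    simpa [h₀ x y h] using h₁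

theorem IsParallelScalar.mul_covector (hΩ : IsOpen Ω) (h : (x, y) ∈ Ω)
    (hF : IsParallelScalar Ω L k x y F) (hw : IsParallelCovector Ω L k x y w) :
    IsParallelCovector Ω L k x y (fun i u v => F u v * w i u v) where
  smooth i := hF.smooth.mul (hw.smooth i)
  delta_eq i := by
    rw [(isTangentDeriv_delta L k x y).mul hΩ h hF.smooth (hw.smooth i), hF.delta_eq, hw.delta_eq,
      zero_mul, zero_add, Finset.mul_sum]
    exact Finset.sum_congr rfl fun r _ => by ring

theorem IsParallelCovector.add (hΩ : IsOpen Ω) (h : (x, y) ∈ Ω)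
    (hw : IsParallelCovector Ω L k x y w) (hw' : IsParallelCovector Ω L k x y w') :
    IsParallelCovector Ω L k x y (fun i u v => w i u v + w' i u v) where
  smooth i := (hw.smooth i).add (hw'.smooth i)
  delta_eq i := by
    rw [(isTangentDeriv_delta L k x y).add hΩ h (hw.smooth i) (hw'.smooth i), hw.delta_eq,
      hw'.delta_eq, ← Finset.sum_add_distrib]
    exact Finset.sum_congr rfl fun r _ => by ring

theorem IsParallelCovector.mul (hΩ : IsOpen Ω) (h : (x, y) ∈ Ω)
    (hw : IsParallelCovector Ω L k x y w) (hw' : IsParallelCovector Ω L k x y w') :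
    IsParallelTensor Ω L k x y (fun i j u v => w i u v * w' j u v) where
  smooth i j := (hw.smooth i).mul (hw'.smooth j)
  delta_eq i j := by
    rw [(isTangentDeriv_delta L k x y).mul hΩ h (hw.smooth i) (hw'.smooth j), hw.delta_eq,
      hw'.delta_eq, Finset.sum_mul, Finset.mul_sum]
    congr 1 <;> exact Finset.sum_congr rfl fun r _ => by ring

theorem IsParallelScalar.mul_tensor (hΩ : IsOpen Ω) (h : (x, y) ∈ Ω)
    (hF : IsParallelScalar Ω L k x y F) (hT : IsParallelTensor Ω L k x y T) :
    IsParallelTensor Ω L k x y (fun i j u v => F u v * T i j u v) where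
  smooth i j := hF.smooth.mul (hT.smooth i j)
  delta_eq i j := by
    rw [(isTangentDeriv_delta L k x y).mul hΩ h hF.smooth (hT.smooth i j), hF.delta_eq,
      hT.delta_eq, zero_mul, zero_add, mul_add, Finset.mul_sum, Finset.mul_sum]
    congr 1 <;> exact Finset.sum_congr rfl fun r _ => by ring

theorem IsParallelTensor.add (hΩ : IsOpen Ω) (h : (x, y) ∈ Ω)
    (hT : IsParallelTensor Ω L k x y T) (hT' : IsParallelTensor Ω L k x y T') :
    IsParallelTensor Ω L k x y (fun i j u v => T i j u v + T' i j u v) where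
  smooth i j := (hT.smooth i j).add (hT'.smooth i j)
  delta_eq i j := by
    rw [(isTangentDeriv_delta L k x y).add hΩ h (hT.smooth i j) (hT'.smooth i j), hT.delta_eq,
      hT'.delta_eq]
    simp only [add_mul, Finset.sum_add_distrib]
    ring

theorem IsParallelTensor.sub (hΩ : IsOpen Ω) (h : (x, y) ∈ Ω)
    (hT : IsParallelTensor Ω L k x y T) (hT' : IsParallelTensor Ω L k x y T') :
    IsParallelTensor Ω L k x y (fun i j u v => T i j u v - T' i j u v) where
  smooth i j := (hT.smooth i j).sub (hT'.smooth i j)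
  delta_eq i j := by
    rw [(isTangentDeriv_delta L k x y).sub hΩ h (hT.smooth i j) (hT'.smooth i j), hT.delta_eq,
      hT'.delta_eq]
    simp only [sub_mul, Finset.sum_sub_distrib]
    ring

theorem IsParallelTensor.congr (hΩ : IsOpen Ω) (h : (x, y) ∈ Ω)
    (hT : IsParallelTensor Ω L k x y T) (e : ∀ i j u v, (u, v) ∈ Ω → T' i j u v = T i j u v) :
    IsParallelTensor Ω L k x y T' where
  smooth i j := (hT.smooth i j).congr (e i j)
  delta_eq i j := by
    rw [(isTangentDeriv_delta L k x y).congr hΩ h ((hT.smooth i j).congr (e i j)) (e i j),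
      hT.delta_eq]
    simp only [e _ _ x y h]

end Parallel

/-! ### Parallel objects built from `L`, and comparison of two Finsler functions -/

namespace IsLocalFinsler

variable {Ω : Set (Coord n × Coord n)} {L L' : Coord n → Coord n → ℝ} {x y : Coord n}

theorem pdy_energy_eq (H : IsLocalFinsler Ω L) (h : (x, y) ∈ Ω) (i : Fin n) :
    pdy i (energy L) x y = 2 * (L x y * pdy i L x y) := by
  rw [show energy L = fun u v => L u v * L u v from funext₂ fun u v => pow_two _,
    (isTangentDeriv_pdy i x y).mul H.isOpen h H.smooth H.smooth]
  ring

theorem isParallelScalar_self (H : IsLocalFinsler Ω L) (h : (x, y) ∈ Ω) (k : Fin n) :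
    IsParallelScalar Ω L k x y L where
  smooth := H.smooth
  delta_eq := by
    have h₁ := H.delta_energy h k
    rw [show energy L = fun u v => L u v * L u v from funext₂ fun u v => pow_two _,
      (isTangentDeriv_delta L k x y).mul H.isOpen h H.smooth H.smooth] at h₁
    have := (H.pos x y h).ne'
    have h₂ : L x y * delta L k L x y = 0 := by linarith
    simpa [this] using h₂

theorem isParallelCovector_pdy (H : IsLocalFinsler Ω L) (h : (x, y) ∈ Ω) (k : Fin n) :
    IsParallelCovector Ω L k x y (fun i => pdy i L) where
  smooth i := H.smooth.pdy H.isOpen i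
  delta_eq i := by
    have hT := isTangentDeriv_delta L k x y
    have hs := H.smooth.pdy H.isOpen i
    have h₁ := hT.congr H.isOpen h (H.smooth_pdy_energy i) fun u v huv => H.pdy_energy_eq huv i
    rw [H.delta_pdy_energy h, hT.const_mul H.isOpen h (H.smooth.mul hs),
      hT.mul H.isOpen h H.smooth hs, (H.isParallelScalar_self h k).delta_eq] at h₁
    have h₂ : ∑ r, pdy r (energy L) x y * cartan L r i k x y =
        2 * (L x y * ∑ r, pdy r L x y * cartan L r i k x y) := by
      simp only [Finset.mul_sum]
      exact Finset.sum_congr rfl fun r _ => by rw [H.pdy_energy_eq h]; ring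
    rw [h₂] at h₁
    refine mul_left_cancel₀ (H.pos x y h).ne' ?_
    linarith

theorem isParallelTensor_metric (H : IsLocalFinsler Ω L) (h : (x, y) ∈ Ω) (k : Fin n) :
    IsParallelTensor Ω L k x y (fun i j u v => metric L u v i j) where
  smooth := H.smooth_metric
  delta_eq i j := H.delta_metric_eq h i j k

theorem metric_eq (H : IsLocalFinsler Ω L) (h : (x, y) ∈ Ω) (i j : Fin n) :
    metric L x y i j = L x y * pdy i (pdy j L) x y + pdy i L x y * pdy j L x y := by
  have hT := isTangentDeriv_pdy i x y
  have hs := H.smooth.pdy H.isOpen j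
  rw [metric_apply, hT.congr H.isOpen h (H.smooth_pdy_energy j)
    fun u v huv => H.pdy_energy_eq huv j, hT.const_mul H.isOpen h (H.smooth.mul hs),
    hT.mul H.isOpen h H.smooth hs]
  ring

/-- `metric_eq` is solved for the Hessian, `∂̇ᵢ∂̇ⱼL = L⁻¹(gᵢⱼ - ∂̇ᵢL ∂̇ⱼL)`, and every ingredient on
the right is parallel. -/
theorem isParallelTensor_pdy_pdy (H : IsLocalFinsler Ω L) (h : (x, y) ∈ Ω) (k : Fin n) :
    IsParallelTensor Ω L k x y (fun i j => pdy i (pdy j L)) := by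
  have hw := H.isParallelCovector_pdy h k
  refine (((H.isParallelScalar_self h k).inv H.isOpen h
    fun u v huv => (H.pos u v huv).ne').mul_tensor H.isOpen h
    ((H.isParallelTensor_metric h k).sub H.isOpen h (hw.mul H.isOpen h hw))).congr H.isOpen h
    fun i j u v huv => ?_
  have := (H.pos u v huv).ne'
  rw [H.metric_eq huv]
  field_simp
  ring

/-- If the energy of `L'` is constant along the horizontal distribution of `L`, the two
canonical sprays agree. -/
theorem spray_eq_of_delta_energy (H : IsLocalFinsler Ω L) (H' : IsLocalFinsler Ω L')
    (hd : ∀ u v, (u, v) ∈ Ω → ∀ k, delta L k (energy L') u v = 0) (h : (x, y) ∈ Ω) (i : Fin n) :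
    spray L' i x y = spray L i x y := by
  refine congrFun (H'.metric_injective h (a := fun i => spray L' i x y)
    (c := fun i => spray L i x y) fun r => ?_) i
  refine mul_left_cancel₀ (four_ne_zero (α := ℝ)) ?_
  rw [H'.metric_mul_spray h]
  have hT := isTangentDeriv_pdy r x y
  -- Apply `∂̇ᵣ` to `yʲNⁱⱼ = 2Gⁱ`; the factor `∂̇ᵣyʲ` accounts for one of the two copies of `Nⁱᵣ`.
  have hN (i : Fin n) : ∑ j, y j * pdy r (barthel L i j) x y = barthel L i r x y := by
    have s : ∀ j ∈ Finset.univ, SmoothOn Ω (fun u v => v j * barthel L i j u v) :=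
      fun j _ => (SmoothOn.fibreCoord j).mul (H.smooth_barthel i j)
    have h₁ := hT.congr H.isOpen h (SmoothOn.sum s) fun u v huv => H.euler_spray huv i
    rw [hT.sum H.isOpen h s, hT.const_mul H.isOpen h (H.smooth_spray i)] at h₁
    have h₂ (j : Fin n) : pdy r (fun u v => v j * barthel L i j u v) x y =
        (if j = r then barthel L i j x y else 0) + y j * pdy r (barthel L i j) x y := by
      rw [hT.mul H.isOpen h (SmoothOn.fibreCoord j) (H.smooth_barthel i j), pdy_fibreCoord]
      simp
    simp only [h₂, Finset.sum_add_distrib, Finset.sum_ite_eq', Finset.mem_univ, if_true] at h₁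
    have h₃ : pdy r (spray L i) x y = barthel L i r x y := rfl
    linarith
  -- Horizontal constancy reads `∂ⱼE' = Nⁱⱼ∂̇ᵢE'` on all of `Ω`, so it may be differentiated in
  -- `yʳ`. After contraction with `yʲ`, the right side of the Euler–Lagrange form for `L'` becomes
  -- `4g'ᵣᵢGⁱ`.
  have h₁ (j : Fin n) : pdx j (pdy r (energy L')) x y =
      ∑ i, (pdy r (barthel L i j) x y * pdy i (energy L') x y +
        2 * (barthel L i j x y * metric L' x y r i)) := by
    have s : ∀ i ∈ Finset.univ, SmoothOn Ω (fun u v => barthel L i j u v * pdy i (energy L') u v) :=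
      fun i _ => (H.smooth_barthel i j).mul (H'.smooth_pdy_energy i)
    have e := hT.congr H.isOpen h (H'.smooth_energy.pdx H.isOpen j)
      (G := fun u v => ∑ i, barthel L i j u v * pdy i (energy L') u v)
      fun u v huv => sub_eq_zero.1 (hd u v huv j)
    rw [hT.sum H.isOpen h s, ← H'.smooth_energy.pdx_pdy_comm H.isOpen h] at e
    rw [e]
    refine Finset.sum_congr rfl fun i _ => ?_
    rw [hT.mul H.isOpen h (H.smooth_barthel i j) (H'.smooth_pdy_energy i), metric_apply]
    ring
  have h₂ : ∑ j, y j * pdx j (pdy r (energy L')) x y =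
      ∑ i, (barthel L i r x y * pdy i (energy L') x y +
        4 * (metric L' x y r i * spray L i x y)) := by
    simp only [h₁, Finset.mul_sum]
    rw [Finset.sum_comm]
    refine Finset.sum_congr rfl fun i _ => ?_
    have e : 4 * (metric L' x y r i * spray L i x y) =
        2 * metric L' x y r i * ∑ j, y j * barthel L i j x y := by
      rw [H.euler_spray h]
      ring
    rw [e, ← hN i, Finset.sum_mul, Finset.mul_sum, ← Finset.sum_add_distrib]
    exact Finset.sum_congr rfl fun j _ => by ring
  have h₃ : pdx r (energy L') x y = ∑ i, barthel L i r x y * pdy i (energy L') x y :=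
    sub_eq_zero.1 (hd x y h r)
  rw [h₂, h₃, Finset.sum_add_distrib, ← Finset.mul_sum]
  ring

theorem delta_congr {F : Coord n → Coord n → ℝ}
    (hN : ∀ i j, barthel L' i j x y = barthel L i j x y) (k : Fin n) :
    delta L' k F x y = delta L k F x y := by
  simp only [delta, hN]

theorem barthel_eq_of_cartan_eq (H : IsLocalFinsler Ω L) (H' : IsLocalFinsler Ω L')
    (h : (x, y) ∈ Ω) (hC : ∀ i j k, cartan L' i j k x y = cartan L i j k x y) (i j : Fin n) :
    barthel L' i j x y = barthel L i j x y := by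
  simp only [← H.cartan_mul_fibreCoord h, ← H'.cartan_mul_fibreCoord h, hC]

end IsLocalFinsler

/-! ### Generalized `β`-conformal changes in local coordinates -/

/-- The conformally changed function `e^σ L`. -/
noncomputable def conformal (s : Coord n → ℝ) (L : Coord n → Coord n → ℝ) : Coord n → Coord n → ℝ :=
  fun u v => Real.exp (s u) * L u v

/-- The one-form `bᵢ(x) yⁱ`. -/
noncomputable def oneForm (b : Fin n → Coord n → ℝ) : Coord n → Coord n → ℝ := fun u v => ∑ i, b i u * v i

/-- `L' = f(e^σ L, β)` is a generalized `β`-conformal change of `L` on `Ω`. -/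
structure IsLocalChange (Ω : Set (Coord n × Coord n)) (L L' : Coord n → Coord n → ℝ)
    (s : Coord n → ℝ) (b : Fin n → Coord n → ℝ) (U : Set (ℝ × ℝ)) (f : ℝ × ℝ → ℝ) : Prop where
  finsler : IsLocalFinsler Ω L
  finsler' : IsLocalFinsler Ω L'
  smooth_s : SmoothOn Ω (fun u _ => s u)
  smooth_b : ∀ i, SmoothOn Ω (fun u _ => b i u)
  isOpen_U : IsOpen U
  smooth_f : ContDiffOn ℝ ∞ f U
  mapsTo : ∀ u v, (u, v) ∈ Ω → (conformal s L u v, oneForm b u v) ∈ U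
  eq : L' = fun u v => f (conformal s L u v, oneForm b u v)

namespace IsLocalChange

variable {Ω : Set (Coord n × Coord n)} {L L' : Coord n → Coord n → ℝ} {s : Coord n → ℝ}
  {b : Fin n → Coord n → ℝ} {U : Set (ℝ × ℝ)} {f : ℝ × ℝ → ℝ} {x y : Coord n}

theorem smooth_exp (C : IsLocalChange Ω L L' s b U f) :
    SmoothOn Ω (fun u _ => Real.exp (s u)) := ContDiffOn.exp C.smooth_s

theorem smooth_conformal (C : IsLocalChange Ω L L' s b U f) : SmoothOn Ω (conformal s L) :=
  C.smooth_exp.mul C.finsler.smooth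

theorem smooth_oneForm (C : IsLocalChange Ω L L' s b U f) : SmoothOn Ω (oneForm b) :=
  SmoothOn.sum fun i _ => (C.smooth_b i).mul (SmoothOn.fibreCoord i)

theorem smooth_comp (C : IsLocalChange Ω L L' s b U f) {H : ℝ × ℝ → ℝ}
    (hH : ContDiffOn ℝ ∞ H U) : SmoothOn Ω (fun u v => H (conformal s L u v, oneForm b u v)) :=
  SmoothOn.comp₂ hH C.smooth_conformal C.smooth_oneForm C.mapsTo

theorem tangentDeriv_comp (C : IsLocalChange Ω L L' s b U f) (h : (x, y) ∈ Ω)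
    {T : (Coord n → Coord n → ℝ) → ℝ} (hT : IsTangentDeriv T x y) {H : ℝ × ℝ → ℝ}
    (hH : ContDiffOn ℝ ∞ H U) :
    T (fun u v => H (conformal s L u v, oneForm b u v)) =
      fderiv ℝ H (conformal s L x y, oneForm b x y) (1, 0) * T (conformal s L) +
        fderiv ℝ H (conformal s L x y, oneForm b x y) (0, 1) * T (oneForm b) :=
  hT.comp₂ C.finsler.isOpen h C.smooth_conformal C.smooth_oneForm
    ((hH.contDiffAt (C.isOpen_U.mem_nhds (C.mapsTo x y h))).differentiableAt (by simp))

theorem pdy_conformal (C : IsLocalChange Ω L L' s b U f) (h : (x, y) ∈ Ω) (i : Fin n) :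
    pdy i (conformal s L) x y = Real.exp (s x) * pdy i L x y := by
  have := (isTangentDeriv_pdy i x y).mul C.finsler.isOpen h C.smooth_exp C.finsler.smooth
  rw [pdy_base, zero_mul, zero_add] at this
  exact this

theorem pdy_oneForm (C : IsLocalChange Ω L L' s b U f) (h : (x, y) ∈ Ω) (i : Fin n) :
    pdy i (oneForm b) x y = b i x := by
  have hT := isTangentDeriv_pdy i x y
  have hs : ∀ j ∈ Finset.univ, SmoothOn Ω (fun u v => b j u * v j) :=
    fun j _ => (C.smooth_b j).mul (SmoothOn.fibreCoord j)
  have h₁ (j : Fin n) : pdy i (fun u v => b j u * v j) x y = if j = i then b j x else 0 := by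
    rw [hT.mul C.finsler.isOpen h (C.smooth_b j) (SmoothOn.fibreCoord j), pdy_base, pdy_fibreCoord]
    simp
  refine (hT.sum C.finsler.isOpen h hs).trans ?_
  simp [h₁]

theorem delta_conformal (C : IsLocalChange Ω L L' s b U f) (h : (x, y) ∈ Ω) (k : Fin n) :
    delta L k (conformal s L) x y = pdx k (fun u _ => s u) x y * conformal s L x y := by
  have := (isTangentDeriv_delta L k x y).mul C.finsler.isOpen h C.smooth_exp C.finsler.smooth
  rw [(C.finsler.isParallelScalar_self h k).delta_eq, delta_base,
    pdx_exp_base C.finsler.isOpen h C.smooth_s] at this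
  rw [conformal]
  refine Eq.trans this ?_
  ring

/-- The term `-bⱼNʲₖ` coming from `δₖyʲ` equals `-bⱼΓʲᵣₖyʳ`, which completes `δₖbⱼ` to the covariant
derivative. -/
theorem delta_oneForm (C : IsLocalChange Ω L L' s b U f) (h : (x, y) ∈ Ω) (k : Fin n) :
    delta L k (oneForm b) x y = ∑ j, hCovDeriv L b j k x y * y j := by
  have hT := isTangentDeriv_delta L k x y
  have hs : ∀ j ∈ Finset.univ, SmoothOn Ω (fun u v => b j u * v j) :=
    fun j _ => (C.smooth_b j).mul (SmoothOn.fibreCoord j)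
  refine Eq.trans (hT.sum C.finsler.isOpen h hs) ?_
  have h₁ (j : Fin n) : delta L k (fun u v => b j u * v j) x y =
      delta L k (fun u _ => b j u) x y * y j - b j x * ∑ r, cartan L j r k x y * y r := by
    rw [hT.mul C.finsler.isOpen h (C.smooth_b j) (SmoothOn.fibreCoord j), delta_fibreCoord,
      C.finsler.cartan_mul_fibreCoord h]
    ring
  simp only [h₁, hCovDeriv, sub_mul, Finset.sum_sub_distrib, Finset.mul_sum, Finset.sum_mul]
  congr 1
  rw [Finset.sum_comm]
  exact Finset.sum_congr rfl fun j _ => Finset.sum_congr rfl fun r _ => by ring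

theorem isParallelScalar_conformal (C : IsLocalChange Ω L L' s b U f) (h : (x, y) ∈ Ω) {k : Fin n}
    (hs : pdx k (fun u _ => s u) x y = 0) : IsParallelScalar Ω L k x y (conformal s L) where
  smooth := C.smooth_conformal
  delta_eq := by rw [C.delta_conformal h, hs, zero_mul]

theorem isParallelScalar_exp (C : IsLocalChange Ω L L' s b U f) (h : (x, y) ∈ Ω) {k : Fin n}
    (hs : pdx k (fun u _ => s u) x y = 0) :
    IsParallelScalar Ω L k x y (fun u _ => Real.exp (s u)) where
  smooth := C.smooth_exp
  delta_eq := by rw [delta_base, pdx_exp_base C.finsler.isOpen h C.smooth_s, hs, mul_zero]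

theorem isParallelCovector_conformal (C : IsLocalChange Ω L L' s b U f) (h : (x, y) ∈ Ω)
    {k : Fin n} (hs : pdx k (fun u _ => s u) x y = 0) :
    IsParallelCovector Ω L k x y (fun i u v => Real.exp (s u) * pdy i L u v) :=
  (C.isParallelScalar_exp h hs).mul_covector C.finsler.isOpen h (C.finsler.isParallelCovector_pdy h k)

theorem pdy_comp (C : IsLocalChange Ω L L' s b U f) (h : (x, y) ∈ Ω) (i : Fin n) {H : ℝ × ℝ → ℝ}
    (hH : ContDiffOn ℝ ∞ H U) :
    pdy i (fun u v => H (conformal s L u v, oneForm b u v)) x y =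
      fderiv ℝ H (conformal s L x y, oneForm b x y) (1, 0) * (Real.exp (s x) * pdy i L x y) +
        fderiv ℝ H (conformal s L x y, oneForm b x y) (0, 1) * b i x := by
  rw [C.tangentDeriv_comp h (isTangentDeriv_pdy i x y) hH, C.pdy_conformal h, C.pdy_oneForm h]

theorem pdy_change (C : IsLocalChange Ω L L' s b U f) (h : (x, y) ∈ Ω) (i : Fin n) :
    pdy i L' x y =
      fderiv ℝ f (conformal s L x y, oneForm b x y) (1, 0) * (Real.exp (s x) * pdy i L x y) +
        fderiv ℝ f (conformal s L x y, oneForm b x y) (0, 1) * b i x := by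
  rw [C.eq, C.pdy_comp h i C.smooth_f]

/-- `∂f/∂L` cannot vanish on a whole fibre: otherwise the new metric tensor has rank one. -/
theorem exists_fderiv_ne_zero (C : IsLocalChange Ω L L' s b U f) (hn : 2 ≤ n)
    (h : (x, y) ∈ Ω) : ∃ v, (x, v) ∈ Ω ∧
      fderiv ℝ f (conformal s L x v, oneForm b x v) (1, 0) ≠ 0 := by
  by_contra! h₀
  have hΩ := C.finsler.isOpen
  set μ : Coord n → Coord n → ℝ :=
    fun u v => 2 * (L' u v * fderiv ℝ f (conformal s L u v, oneForm b u v) (0, 1)) with hμ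
  have sμ : SmoothOn Ω μ := (SmoothOn.const 2).mul (C.finsler'.smooth.mul
    (C.smooth_comp (contDiffOn_fderiv_apply C.isOpen_U C.smooth_f (0, 1))))
  -- With `f₁ = 0` on the fibre, the vertical gradient of the energy is a multiple of the covector
  -- `b(x)`, which is constant along that fibre; its derivative in `y` is then an outer product.
  have h₁ (j : Fin n) (v : Coord n) (hv : (x, v) ∈ Ω) :
      pdy j (energy L') x v = μ x v * b j x := by
    rw [C.finsler'.pdy_energy_eq hv, C.pdy_change hv, h₀ v hv, hμ]
    ring
  have hd : DifferentiableAt ℝ (fun v => μ x v) y :=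
    (sμ.differentiableAt hΩ h).comp y (f := fun v : Coord n => (x, v)) (by fun_prop)
  have h₂ (i j : Fin n) : pdy i (pdy j (energy L')) x y = pdy i μ x y * b j x := by
    have e : (fun v => pdy j (energy L') x v) =ᶠ[nhds y] fun v => μ x v * b j x := by
      have : Filter.Tendsto (fun v : Coord n => (x, v)) (nhds y) (nhds (x, y)) := by
        exact (Continuous.prodMk_right x).tendsto y
      filter_upwards [this.eventually (hΩ.mem_nhds h)] with v hv using h₁ j v hv
    rw [pdy, e.fderiv_eq (𝕜 := ℝ), fderiv_mul_const hd, pdy]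
    simp [mul_comm]
  have h₃ : metric L' x y =
      Matrix.vecMulVec (fun i => (1 / 2) * pdy i μ x y) (fun j => b j x) := by
    ext i j
    rw [metric_apply, h₂, Matrix.vecMulVec_apply, mul_assoc]
  have : Nontrivial (Fin n) := Fin.nontrivial_iff_two_le.2 hn
  exact C.finsler'.nondegenerate x y h (by rw [h₃, Matrix.det_vecMulVec])

/-- The chain rule for `δₖ f(e^σ L, β)`. Equality of the Cartan connections makes `δ` the horizontal
derivative of `L'` as well, and `L'` is horizontally constant for its own connection. -/
theorem delta_change (C : IsLocalChange Ω L L' s b U f) (h : (x, y) ∈ Ω)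
    (hC : ∀ i j k, cartan L' i j k x y = cartan L i j k x y) (k : Fin n) :
    fderiv ℝ f (conformal s L x y, oneForm b x y) (1, 0) *
        (pdx k (fun u _ => s u) x y * conformal s L x y) +
      fderiv ℝ f (conformal s L x y, oneForm b x y) (0, 1) *
        ∑ j, hCovDeriv L b j k x y * y j = 0 := by
  rw [← C.delta_conformal h, ← C.delta_oneForm h,
    ← C.tangentDeriv_comp h (isTangentDeriv_delta L k x y) C.smooth_f, ← C.eq,
    ← (C.finsler'.isParallelScalar_self h k).delta_eq]
  exact (IsLocalFinsler.delta_congr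
    (C.finsler.barthel_eq_of_cartan_eq C.finsler' h hC) k).symm

theorem pdx_eq_zero (C : IsLocalChange Ω L L' s b U f) (hn : 2 ≤ n) (h : (x, y) ∈ Ω)
    (hb : ∀ v, (x, v) ∈ Ω → ∀ j k, hCovDeriv L b j k x v = 0)
    (hC : ∀ v, (x, v) ∈ Ω → ∀ i j k, cartan L' i j k x v = cartan L i j k x v) (k : Fin n) :
    fderiv ℝ s x (EuclideanSpace.single k 1) = 0 := by
  obtain ⟨v, hv, hf⟩ := C.exists_fderiv_ne_zero hn h
  have h₁ := C.delta_change hv (hC v hv) k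
  simp only [hb v hv, zero_mul, Finset.sum_const_zero, mul_zero, add_zero] at h₁
  have h₂ : conformal s L x v ≠ 0 :=
    mul_ne_zero (Real.exp_ne_zero _) (C.finsler.pos x v hv).ne'
  simpa [hf, h₂, pdx] using h₁

/-- `delta_change` gives only the contraction `b_{j|k}yʲ = 0`, that is, `δₖβ = 0`. This makes `f₁`
and `f₂` horizontally constant, and the parallelism of the whole covector `∂̇ⱼL'` then recovers
every component. -/
theorem hCovDeriv_eq_zero (C : IsLocalChange Ω L L' s b U f) (h : (x, y) ∈ Ω)
    (hs : fderiv ℝ s x = 0) (hC : ∀ i j k, cartan L' i j k x y = cartan L i j k x y)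
    (hf : fderiv ℝ f (conformal s L x y, oneForm b x y) (0, 1) ≠ 0) (j k : Fin n) :
    hCovDeriv L b j k x y = 0 := by
  have hΩ := C.finsler.isOpen
  have hs' : pdx k (fun u _ => s u) x y = 0 := by simp [pdx, hs]
  have hN := C.finsler.barthel_eq_of_cartan_eq C.finsler' h hC
  have h₁ := C.delta_change h hC k
  rw [hs', zero_mul, mul_zero, zero_add] at h₁
  have hA := C.isParallelScalar_conformal h hs'
  have hB : IsParallelScalar Ω L k x y (oneForm b) :=
    ⟨C.smooth_oneForm, by rw [C.delta_oneForm h]; simpa [hf] using h₁⟩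
  have h₂ (w : ℝ × ℝ) := hA.comp₂ hΩ h hB C.isOpen_U
    (contDiffOn_fderiv_apply C.isOpen_U C.smooth_f w) C.mapsTo
  have hT := isTangentDeriv_delta L k x y
  have hP := (h₂ (1, 0)).mul_covector hΩ h (C.isParallelCovector_conformal h hs')
  have s₂ := (h₂ (0, 1)).smooth
  -- Expand `δₖ(f₁e^σ∂̇ⱼL + f₂bⱼ)`: the first summand is already parallel, and comparison leaves `f₂
  -- b_{j|k} = 0`.
  have h₃ := (C.finsler'.isParallelCovector_pdy h k).delta_eq j
  rw [IsLocalFinsler.delta_congr hN k,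
    hT.congr hΩ h (C.finsler'.smooth.pdy hΩ j) fun u v huv => C.pdy_change huv j,
    hT.add hΩ h (hP.smooth j) (s₂.mul (C.smooth_b j)), hP.delta_eq,
    hT.mul hΩ h s₂ (C.smooth_b j), (h₂ (0, 1)).delta_eq] at h₃
  simp only [C.pdy_change h, hC, add_mul, Finset.sum_add_distrib] at h₃
  have h₄ : ∑ r, fderiv ℝ f (conformal s L x y, oneForm b x y) (0, 1) * b r x *
      cartan L r j k x y = fderiv ℝ f (conformal s L x y, oneForm b x y) (0, 1) *
        ∑ r, b r x * cartan L r j k x y := by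
    rw [Finset.mul_sum]
    exact Finset.sum_congr rfl fun r _ => by ring
  rw [h₄] at h₃
  refine (mul_eq_zero.1 (?_ : fderiv ℝ f (conformal s L x y, oneForm b x y) (0, 1) *
    hCovDeriv L b j k x y = 0)).resolve_left hf
  rw [hCovDeriv, mul_sub]
  linarith

theorem cartan_eq (C : IsLocalChange Ω L L' s b U f)
    (hs : ∀ u v, (u, v) ∈ Ω → fderiv ℝ s u = 0)
    (hb : ∀ u v, (u, v) ∈ Ω → ∀ j k, hCovDeriv L b j k u v = 0) (h : (x, y) ∈ Ω)
    (i j k : Fin n) : cartan L' i j k x y = cartan L i j k x y := by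
  have hΩ := C.finsler.isOpen
  have hs' (u v : Coord n) (huv : (u, v) ∈ Ω) (k : Fin n) : pdx k (fun u _ => s u) u v = 0 := by
    simp [pdx, hs u v huv]
  have hA {u v : Coord n} (huv : (u, v) ∈ Ω) (k : Fin n) :=
    C.isParallelScalar_conformal huv (hs' u v huv k)
  have hB {u v : Coord n} (huv : (u, v) ∈ Ω) (k : Fin n) :
      IsParallelScalar Ω L k u v (oneForm b) :=
    ⟨C.smooth_oneForm, by rw [C.delta_oneForm huv]; simp [hb u v huv]⟩
  have hpar {u v : Coord n} (huv : (u, v) ∈ Ω) (k : Fin n) {H : ℝ × ℝ → ℝ}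
      (hH : ContDiffOn ℝ ∞ H U) := (hA huv k).comp₂ hΩ huv (hB huv k) C.isOpen_U hH C.mapsTo
  -- Working with `F = f²` makes the energy of `L'` itself a function of `(e^σ L, β)`, so the metric
  -- comes directly from second derivatives of `F`.
  have hF : ContDiffOn ℝ ∞ (fun z => f z ^ 2) U := C.smooth_f.pow 2
  have hE : energy L' = fun u v => (fun z => f z ^ 2) (conformal s L u v, oneForm b u v) := by
    rw [C.eq]
    rfl
  have hspray {u v : Coord n} (huv : (u, v) ∈ Ω) (i : Fin n) : spray L' i u v = spray L i u v :=
    C.finsler.spray_eq_of_delta_energy C.finsler'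
      (fun u v huv k => by rw [hE]; exact (hpar huv k hF).delta_eq) huv i
  have hN (i j : Fin n) : barthel L' i j x y = barthel L i j x y :=
    (isTangentDeriv_pdy j x y).congr hΩ h (C.finsler'.smooth_spray i) fun u v huv => hspray huv i
  have hE₁ (j : Fin n) (u v : Coord n) (huv : (u, v) ∈ Ω) : pdy j (energy L') u v =
      fderiv ℝ (fun z => f z ^ 2) (conformal s L u v, oneForm b u v) (1, 0) *
          (Real.exp (s u) * pdy j L u v) +
        fderiv ℝ (fun z => f z ^ 2) (conformal s L u v, oneForm b u v) (0, 1) * b j u := by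
    rw [hE, C.pdy_comp huv j hF]
  have hF' (w : ℝ × ℝ) := contDiffOn_fderiv_apply C.isOpen_U hF w
  have hF'' (w w' : ℝ × ℝ) := contDiffOn_fderiv_apply C.isOpen_U (hF' w) w'
  have hmetric (k : Fin n) : IsParallelTensor Ω L k x y (fun i j u v => metric L' u v i j) := by
    have pA := C.isParallelCovector_conformal h (hs' x y h k)
    have pb : IsParallelCovector Ω L k x y (fun i u _ => b i u) :=
      ⟨C.smooth_b, fun i => sub_eq_zero.1 (hb x y h i k)⟩
    have pAA := (C.isParallelScalar_exp h (hs' x y h k)).mul_tensor hΩ h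
      (C.finsler.isParallelTensor_pdy_pdy h k)
    have pc (w : ℝ × ℝ) := ((hpar h k (hF'' w (1, 0))).mul_covector hΩ h pA).add hΩ h
      ((hpar h k (hF'' w (0, 1))).mul_covector hΩ h pb)
    have ph : IsParallelScalar Ω L k x y (fun _ _ => 1 / 2) :=
      ⟨SmoothOn.const _, (isTangentDeriv_delta L k x y).const _⟩
    -- With `Aᵢ = e^σ∂̇ᵢL`, the decomposition is `g'ᵢⱼ = ½((F₁₁Aᵢ + F₁₂bᵢ)Aⱼ + F₁e^σ∂̇ᵢ∂̇ⱼL + (F₂₁Aᵢ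
    -- + F₂₂bᵢ)bⱼ)`, in which each factor is parallel.
    refine (ph.mul_tensor hΩ h ((((pc (1, 0)).mul hΩ h pA).add hΩ h
      ((hpar h k (hF' (1, 0))).mul_tensor hΩ h pAA)).add hΩ h ((pc (0, 1)).mul hΩ h pb))).congr
      hΩ h fun i j u v huv => ?_
    have hT := isTangentDeriv_pdy i u v
    have sL := C.finsler.smooth.pdy hΩ j
    have s₁ := C.smooth_comp (hF' (1, 0))
    have s₂ := C.smooth_comp (hF' (0, 1))
    rw [metric_apply, hT.congr hΩ huv (C.finsler'.smooth_pdy_energy j) (hE₁ j),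
      hT.add hΩ huv (s₁.mul (C.smooth_exp.mul sL)) (s₂.mul (C.smooth_b j)),
      hT.mul hΩ huv s₁ (C.smooth_exp.mul sL), hT.mul hΩ huv C.smooth_exp sL,
      hT.mul hΩ huv s₂ (C.smooth_b j), C.pdy_comp huv i (hF' (1, 0)),
      C.pdy_comp huv i (hF' (0, 1)), pdy_base, pdy_base]
    ring
  symm
  refine C.finsler'.eq_cartan h (C := fun i j k => cartan L i j k x y)
    (fun i j k => C.finsler.cartan_symm h i j k) (fun i j k => ?_) i j k
  rw [IsLocalFinsler.delta_congr hN k]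
  exact (hmetric k).delta_eq i j

end IsLocalChange

end Finsler

namespace Finsler

variable {n : ℕ} {M : Type*} [TopologicalSpace M] [ChartedSpace (Coord n) M]

/-! ### From the manifold to local coordinates -/

theorem contMDiff_tangentBundle_mk : ContMDiff 𝓘(ℝ, Coord n × Coord n) (𝓡 n).tangent ∞
    (fun p : Coord n × Coord n => (⟨p.1, p.2⟩ : TangentBundle (𝓡 n) (Coord n))) := by
  rw [modelWithCornersSelf_prod]
  exact contMDiff_tangentBundleModelSpaceHomeomorph_symm (I := 𝓡 n) (n := ∞)

/-- The part of `𝒟` over the domain of the chart `φ`, in coordinates. -/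
def chartDomain (φ : OpenPartialHomeomorph M (Coord n)) (𝒟 : Set (TangentBundle (𝓡 n) M)) :
    Set (Coord n × Coord n) :=
  {p | p.1 ∈ φ.target ∧ tangentPoint φ p.1 p.2 ∈ 𝒟}

theorem tangentPoint_smul (φ : OpenPartialHomeomorph M (Coord n)) (x y : Coord n) (t : ℝ) :
    tangentPoint φ x (t • y) =
      ⟨(tangentPoint φ x y).1, t • (tangentPoint φ x y).2⟩ := by
  simp only [tangentPoint]
  congr 1
  exact (mfderiv (𝓡 n) (𝓡 n) φ.symm x).map_smul t y

theorem oneForm_localCovector (φ : OpenPartialHomeomorph M (Coord n))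
    (b : ∀ p : M, TangentSpace (𝓡 n) p →L[ℝ] ℝ) (x y : Coord n) :
    oneForm (localCovector φ b) x y = b (tangentPoint φ x y).1 (tangentPoint φ x y).2 := by
  have h := congrArg ((b (φ.symm x)).comp (mfderiv (𝓡 n) (𝓡 n) φ.symm x) : Coord n → ℝ)
    (sum_smul_single y)
  refine Eq.trans ?_ h
  erw [map_sum]
  refine Finset.sum_congr rfl fun i _ => ?_
  erw [map_smul]
  rw [mul_comm]
  rfl

theorem localRep_betaConformalChange (φ : OpenPartialHomeomorph M (Coord n)) (f : ℝ × ℝ → ℝ)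
    (σ : M → ℝ) (b : ∀ p : M, TangentSpace (𝓡 n) p →L[ℝ] ℝ) (L : TangentBundle (𝓡 n) M → ℝ) :
    localRep φ (betaConformalChange f σ b L) = fun u v =>
      f (conformal (fun x => σ (φ.symm x)) (localRep φ L) u v,
        oneForm (localCovector φ b) u v) := by
  funext u v
  rw [oneForm_localCovector]
  rfl

/-- The coordinates of a tangent vector in the chart `φ`. -/
noncomputable def tangentCoord (φ : OpenPartialHomeomorph M (Coord n))
    (v : TangentBundle (𝓡 n) M) : Coord n × Coord n :=
  (φ v.1, mfderiv (𝓡 n) (𝓡 n) φ v.1 v.2)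

/-- Stated for an arbitrary `v` equal to `tangentPoint φ x y`, so that the effectiveness condition
at a tangent vector can be moved to its coordinates. -/
theorem conformal_oneForm_eq {φ : OpenPartialHomeomorph M (Coord n)} {σ : M → ℝ}
    {L : TangentBundle (𝓡 n) M → ℝ} {b : ∀ p : M, TangentSpace (𝓡 n) p →L[ℝ] ℝ}
    {x y : Coord n} {v : TangentBundle (𝓡 n) M} (h : tangentPoint φ x y = v) :
    (conformal (fun x => σ (φ.symm x)) (localRep φ L) x y, oneForm (localCovector φ b) x y) =
      (Real.exp (σ v.1) * L v, b v.1 v.2) := by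
  subst h
  rw [oneForm_localCovector]
  rfl

/-! ### Charts of the maximal atlas and the induced coordinates on the tangent bundle -/

section Chart

variable {φ : OpenPartialHomeomorph M (Coord n)}

theorem mdifferentiable_of_mem_maximalAtlas (hφ : φ ∈ IsManifold.maximalAtlas (𝓡 n) ∞ M) :
    φ.MDifferentiable (𝓡 n) (𝓡 n) :=
  ⟨(contMDiffOn_of_mem_maximalAtlas hφ).mdifferentiableOn (by simp),
    (contMDiffOn_symm_of_mem_maximalAtlas hφ).mdifferentiableOn (by simp)⟩

theorem contDiffOn_comp_symm (hφ : φ ∈ IsManifold.maximalAtlas (𝓡 n) ∞ M) {σ : M → ℝ}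
    (hσ : ContMDiff (𝓡 n) 𝓘(ℝ, ℝ) ∞ σ) : ContDiffOn ℝ ∞ (fun x => σ (φ.symm x)) φ.target :=
  (hσ.comp_contMDiffOn (contMDiffOn_symm_of_mem_maximalAtlas hφ)).contDiffOn

/-- A manifold is locally connected, so connected components are open and `σ` is constant near each
point. -/
theorem IsHomothetic.fderiv_eq_zero {σ : M → ℝ} (hσ : IsHomothetic σ)
    {x : Coord n} (hx : x ∈ φ.target) : fderiv ℝ (fun x => σ (φ.symm x)) x = 0 := by
  have : LocallyConnectedSpace M := ChartedSpace.locallyConnectedSpace (Coord n) M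
  have e : (fun x => σ (φ.symm x)) =ᶠ[nhds x] fun _ => σ (φ.symm x) := by
    filter_upwards [(φ.continuousAt_symm hx).preimage_mem_nhds
      (isOpen_connectedComponent.mem_nhds (mem_connectedComponent (x := φ.symm x)))] with u hu
      using hσ _ _ hu
  rw [e.fderiv_eq]
  simp

theorem localCovector_eq_zero {b : ∀ p : M, TangentSpace (𝓡 n) p →L[ℝ] ℝ} {x : Coord n}
    (h : b (φ.symm x) = 0) (i : Fin n) : localCovector φ b i x = 0 := by
  rw [localCovector, h]
  rfl

theorem hCovDeriv_eq_zero_of_eventuallyEq {L : Coord n → Coord n → ℝ} {b : Fin n → Coord n → ℝ}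
    {x : Coord n} (hb : ∀ᶠ u in nhds x, ∀ i, b i u = 0) (j k : Fin n) (y : Coord n) :
    hCovDeriv L b j k x y = 0 := by
  have e : (fun u => b j u) =ᶠ[nhds x] fun _ => 0 := hb.mono fun u hu => hu j
  have h₁ : pdx k (fun u _ => b j u) x y = 0 := by
    rw [pdx, e.fderiv_eq]
    simp
  rw [hCovDeriv, delta_base, h₁]
  simp [hb.self_of_nhds]

theorem smooth_hCovDeriv {Ω : Set (Coord n × Coord n)} {L : Coord n → Coord n → ℝ}
    (H : IsLocalFinsler Ω L) {b : Fin n → Coord n → ℝ} (hb : ∀ i, SmoothOn Ω (fun u _ => b i u))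
    (j k : Fin n) : SmoothOn Ω (hCovDeriv L b j k) :=
  (H.smooth_delta k (hb j)).sub (SmoothOn.sum fun r _ => (hb r).mul (H.smooth_cartan r j k))

theorem tangentPoint_tangentCoord (hφ : φ ∈ IsManifold.maximalAtlas (𝓡 n) ∞ M)
    {v : TangentBundle (𝓡 n) M} (hv : v.1 ∈ φ.source) :
    tangentPoint φ (tangentCoord φ v).1 (tangentCoord φ v).2 = v := by
  have h₁ := (mdifferentiable_of_mem_maximalAtlas hφ).symm_comp_deriv hv
  have h₂ : mfderiv (𝓡 n) (𝓡 n) φ.symm (φ v.1) (mfderiv (𝓡 n) (𝓡 n) φ v.1 v.2) = v.2 :=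
    DFunLike.congr_fun h₁ v.2
  exact congrArg₂ (fun (p : M) (w : Coord n) => (⟨p, w⟩ : TangentBundle (𝓡 n) M))
    (φ.left_inv hv) h₂

theorem tangentCoord_tangentPoint (hφ : φ ∈ IsManifold.maximalAtlas (𝓡 n) ∞ M)
    {x : Coord n} (hx : x ∈ φ.target) (y : Coord n) :
    tangentCoord φ (tangentPoint φ x y) = (x, y) :=
  Prod.ext (φ.right_inv hx) (DFunLike.congr_fun
    ((mdifferentiable_of_mem_maximalAtlas hφ).comp_symm_deriv hx) y)

variable [IsManifold (𝓡 n) ∞ M]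

theorem continuousOn_tangentCoord (hφ : φ ∈ IsManifold.maximalAtlas (𝓡 n) ∞ M) :
    ContinuousOn (tangentCoord φ) {v : TangentBundle (𝓡 n) M | v.1 ∈ φ.source} := by
  -- The chart is smooth only on its source; there the tangent map within the open set is the
  -- tangent map.
  have h₁ := (contMDiffOn_of_mem_maximalAtlas hφ).continuousOn_tangentMapWithin (by simp)
    φ.open_source.uniqueMDiffOn
  have h₂ := (tangentBundleModelSpaceHomeomorph (𝓡 n)).continuous.comp_continuousOn h₁
  refine h₂.congr fun v hv => ?_
  have e : tangentMapWithin (𝓡 n) (𝓡 n) φ φ.source v = tangentMap (𝓡 n) (𝓡 n) φ v :=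
    tangentMapWithin_eq_tangentMap (φ.open_source.uniqueMDiffWithinAt hv)
      ((mdifferentiable_of_mem_maximalAtlas hφ).mdifferentiableAt hv)
  simp only [Function.comp_apply, e]
  rfl

theorem contMDiffOn_tangentPoint (hφ : φ ∈ IsManifold.maximalAtlas (𝓡 n) ∞ M) :
    ContMDiffOn 𝓘(ℝ, Coord n × Coord n) (𝓡 n).tangent ∞
      (fun p : Coord n × Coord n => tangentPoint φ p.1 p.2)
      {p : Coord n × Coord n | p.1 ∈ φ.target} := by
  have h₁ := (contMDiffOn_symm_of_mem_maximalAtlas hφ).contMDiffOn_tangentMapWithin (m := ∞)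
    (by simp) φ.open_target.uniqueMDiffOn
  have h₂ := h₁.comp (contMDiff_tangentBundle_mk (n := n)).contMDiffOn
    (s := {p : Coord n × Coord n | p.1 ∈ φ.target}) (fun p hp => hp)
  refine h₂.congr fun p hp => ?_
  exact (tangentMapWithin_eq_tangentMap (p := (⟨p.1, p.2⟩ : TangentBundle (𝓡 n) (Coord n)))
    (φ.open_target.uniqueMDiffWithinAt hp)
    ((mdifferentiable_of_mem_maximalAtlas hφ).mdifferentiableAt_symm hp)).symm

theorem isOpen_chartDomain (hφ : φ ∈ IsManifold.maximalAtlas (𝓡 n) ∞ M)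
    {𝒟 : Set (TangentBundle (𝓡 n) M)} (h𝒟 : IsOpen 𝒟) : IsOpen (chartDomain φ 𝒟) :=
  (contMDiffOn_tangentPoint hφ).continuousOn.isOpen_inter_preimage
    (φ.open_target.preimage continuous_fst) h𝒟

theorem smoothOn_localRep (hφ : φ ∈ IsManifold.maximalAtlas (𝓡 n) ∞ M)
    {𝒟 : Set (TangentBundle (𝓡 n) M)} {F : TangentBundle (𝓡 n) M → ℝ}
    (hF : ContMDiffOn (𝓡 n).tangent 𝓘(ℝ, ℝ) ∞ F 𝒟) :
    SmoothOn (chartDomain φ 𝒟) (localRep φ F) :=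
  (hF.comp ((contMDiffOn_tangentPoint hφ).mono fun _ hp => hp.1) fun _ hp => hp.2).contDiffOn

theorem smoothOn_localCovector (hφ : φ ∈ IsManifold.maximalAtlas (𝓡 n) ∞ M)
    (𝒟 : Set (TangentBundle (𝓡 n) M)) {b : ∀ p : M, TangentSpace (𝓡 n) p →L[ℝ] ℝ}
    (hb : ContMDiff (𝓡 n).tangent 𝓘(ℝ, ℝ) ∞ (fun v : TangentBundle (𝓡 n) M => b v.1 v.2))
    (i : Fin n) : SmoothOn (chartDomain φ 𝒟) (fun u _ => localCovector φ b i u) := by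
  -- The components are `bᵢ(x) = β(x, eᵢ)`. Since `eᵢ` need not represent a vector of `𝒟`,
  -- smoothness of `β` is used on the whole tangent bundle.
  have h := smoothOn_localRep hφ (hb.contMDiffOn (s := Set.univ))
  have hc : ContDiff ℝ ∞ (fun p : Coord n × Coord n =>
      (p.1, (EuclideanSpace.single i (1 : ℝ) : Coord n))) := contDiff_fst.prodMk contDiff_const
  exact ContDiffOn.comp h hc.contDiffOn fun p hp => ⟨hp.1, Set.mem_univ _⟩

theorem IsFinslerFunction.isLocalFinsler {𝒟 : Set (TangentBundle (𝓡 n) M)}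
    (h𝒟 : IsConicDomain 𝒟) {L : TangentBundle (𝓡 n) M → ℝ} (hL : IsFinslerFunction 𝒟 L)
    (hφ : φ ∈ IsManifold.maximalAtlas (𝓡 n) ∞ M) :
    IsLocalFinsler (chartDomain φ 𝒟) (localRep φ L) where
  isOpen := isOpen_chartDomain hφ h𝒟.isOpen
  cone x y h t ht := ⟨h.1, by rw [tangentPoint_smul]; exact h𝒟.smul_mem _ h.2 t ht⟩
  smooth := smoothOn_localRep hφ hL.smooth
  pos x y h := hL.pos _ h.2
  homogeneous x y h t ht := by
    rw [localRep, tangentPoint_smul, hL.homogeneous _ h.2 t ht, pow_one, localRep]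
  nondegenerate x y h := hL.nondegenerate φ hφ x h.1 y h.2

theorem exists_mem_chartDomain {𝒟 : Set (TangentBundle (𝓡 n) M)} (h𝒟 : IsConicDomain 𝒟)
    (hφ : φ ∈ IsManifold.maximalAtlas (𝓡 n) ∞ M) {x : Coord n} (hx : x ∈ φ.target) :
    ∃ y, (x, y) ∈ chartDomain φ 𝒟 := by
  obtain ⟨w, hw⟩ := h𝒟.nonempty (φ.symm x)
  obtain ⟨y, hy⟩ := (mdifferentiable_of_mem_maximalAtlas hφ).symm.mfderiv_surjective hx w
  refine ⟨y, hx, ?_⟩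
  rw [tangentPoint, hy]
  exact hw

theorem isLocalChange {𝒟 : Set (TangentBundle (𝓡 n) M)} (h𝒟 : IsConicDomain 𝒟)
    {L : TangentBundle (𝓡 n) M → ℝ} (hL : IsFinslerFunction 𝒟 L)
    {σ : M → ℝ} (hσ : ContMDiff (𝓡 n) 𝓘(ℝ, ℝ) ∞ σ)
    {b : ∀ p : M, TangentSpace (𝓡 n) p →L[ℝ] ℝ}
    (hb : ContMDiff (𝓡 n).tangent 𝓘(ℝ, ℝ) ∞ (fun v : TangentBundle (𝓡 n) M => b v.1 v.2))
    {U : Set (ℝ × ℝ)} (hU : IsOpen U) {f : ℝ × ℝ → ℝ} (hf : ContDiffOn ℝ ∞ f U)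
    (hmaps : ∀ v ∈ 𝒟, (Real.exp (σ v.1) * L v, b v.1 v.2) ∈ U)
    (hLbar : IsFinslerFunction 𝒟 (betaConformalChange f σ b L))
    (hφ : φ ∈ IsManifold.maximalAtlas (𝓡 n) ∞ M) :
    IsLocalChange (chartDomain φ 𝒟) (localRep φ L) (localRep φ (betaConformalChange f σ b L))
      (fun x => σ (φ.symm x)) (localCovector φ b) U f where
  finsler := hL.isLocalFinsler h𝒟 hφ
  finsler' := hLbar.isLocalFinsler h𝒟 hφ
  smooth_s := (contDiffOn_comp_symm hφ hσ).comp contDiff_fst.contDiffOn fun _ hp => hp.1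
  smooth_b := smoothOn_localCovector hφ 𝒟 hb
  isOpen_U := hU
  smooth_f := hf
  mapsTo u v huv := by
    rw [oneForm_localCovector]
    exact hmaps _ huv.2
  eq := localRep_betaConformalChange φ f σ b L

/-- A zero derivative makes `σ` constant on a coordinate ball around each point, hence locally
constant, hence constant on connected sets. -/
theorem isHomothetic_of_fderiv_eq_zero {σ : M → ℝ} (hσ : ContMDiff (𝓡 n) 𝓘(ℝ, ℝ) ∞ σ)
    (h : ∀ φ ∈ IsManifold.maximalAtlas (𝓡 n) ∞ M, ∀ x ∈ φ.target,
      fderiv ℝ (fun x => σ (φ.symm x)) x = 0) : IsHomothetic σ := by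
  have hloc : IsLocallyConstant σ := by
    refine (IsLocallyConstant.iff_eventually_eq σ).2 fun p => ?_
    set φ := chartAt (Coord n) p
    have hφ : φ ∈ IsManifold.maximalAtlas (𝓡 n) ∞ M := IsManifold.chart_mem_maximalAtlas p
    have hp : p ∈ φ.source := mem_chart_source _ p
    obtain ⟨ε, hε, hball⟩ := Metric.isOpen_iff.1 φ.open_target (φ p) (φ.map_source hp)
    filter_upwards [φ.open_source.mem_nhds hp,
      (φ.continuousAt hp).preimage_mem_nhds (Metric.ball_mem_nhds _ hε)] with q hq hqb
    have hc : σ (φ.symm (φ q)) = σ (φ.symm (φ p)) :=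
      Metric.isOpen_ball.is_const_of_fderiv_eq_zero (f := fun x => σ (φ.symm x))
        (convex_ball (φ p) ε).isPreconnected
        (((contDiffOn_comp_symm hφ hσ).differentiableOn (by simp)).mono hball)
        (fun x hx => h φ hφ x (hball hx)) hqb (Metric.mem_ball_self hε)
    rwa [φ.left_inv hq, φ.left_inv hp] at hc
  intro p q hq
  exact hloc.apply_eq_of_isPreconnected isPreconnected_connectedComponent hq
    mem_connectedComponent

end Chart

end Finsler

/-! ### The theorem on the manifold -/

theorem mainTheorem5 {n : ℕ} (hn : 2 ≤ n) {M : Type*} [TopologicalSpace M]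
    [ChartedSpace (Finsler.Coord n) M] [IsManifold (𝓡 n) ∞ M]
    -- the Finsler manifold `(M, L)`
    (𝒟 : Set (TangentBundle (𝓡 n) M)) (h𝒟 : Finsler.IsConicDomain 𝒟)
    (L : TangentBundle (𝓡 n) M → ℝ) (hL : Finsler.IsFinslerFunction 𝒟 L)
    -- the function `σ(x)` and the one-form `β = bᵢ(x) dxⁱ`
    (σ : M → ℝ) (hσ : ContMDiff (𝓡 n) 𝓘(ℝ, ℝ) ∞ σ)
    (b : ∀ p : M, TangentSpace (𝓡 n) p →L[ℝ] ℝ)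
    (hb : ContMDiff (𝓡 n).tangent 𝓘(ℝ, ℝ) ∞ (fun v : TangentBundle (𝓡 n) M => b v.1 v.2))
    -- the function `f`, smooth and positively homogeneous of degree one on an open cone `U`
    (U : Set (ℝ × ℝ)) (hU : IsOpen U) (hUcone : ∀ z ∈ U, ∀ t : ℝ, 0 < t → t • z ∈ U)
    (f : ℝ × ℝ → ℝ) (hf : ContDiffOn ℝ ∞ f U)
    (hfhom : ∀ z ∈ U, ∀ t : ℝ, 0 < t → f (t • z) = t * f z)
    (hmaps : ∀ v ∈ 𝒟, (Real.exp (σ v.1) * L v, b v.1 v.2) ∈ U)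
    -- `(M, L̄)` is a Finsler space
    (hLbar : Finsler.IsFinslerFunction 𝒟 (Finsler.betaConformalChange f σ b L)) :
    -- (a)
    (Finsler.IsCartanParallel 𝒟 L b ∧
        Finsler.DifferenceTensorVanishes 𝒟 L (Finsler.betaConformalChange f σ b L) →
      Finsler.IsHomothetic σ) ∧
    -- (b); the converse needs `f` to depend effectively on `β`: `∂f/∂β` does not vanish
    -- identically on an open set of directions above points where `b ≠ 0`
    (Finsler.IsHomothetic σ →
      (Finsler.IsCartanParallel 𝒟 L b →
        Finsler.DifferenceTensorVanishes 𝒟 L (Finsler.betaConformalChange f σ b L)) ∧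
      ({v ∈ 𝒟 | b v.1 ≠ 0} ⊆ closure {v ∈ 𝒟 |
          fderiv ℝ f (Real.exp (σ v.1) * L v, b v.1 v.2) (0, 1) ≠ 0} →
        Finsler.DifferenceTensorVanishes 𝒟 L (Finsler.betaConformalChange f σ b L) →
        Finsler.IsCartanParallel 𝒟 L b)) := by
  open Finsler in
  have C {φ : OpenPartialHomeomorph M (Coord n)}
      (hφ : φ ∈ IsManifold.maximalAtlas (𝓡 n) ∞ M) :=
    isLocalChange h𝒟 hL hσ hb hU hf hmaps hLbar hφ
  refine ⟨fun ⟨hpar, hD⟩ => ?_, fun hhom => ⟨fun hpar φ hφ x hx y hy i j k => ?_,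
    fun hdense hD φ hφ x hx y hy j k => ?_⟩⟩
  · refine isHomothetic_of_fderiv_eq_zero hσ fun φ hφ x hx => ?_
    obtain ⟨y, hy⟩ := exists_mem_chartDomain h𝒟 hφ hx
    have h₁ := (C hφ).pdx_eq_zero hn hy (fun v hv => hpar φ hφ x hx v hv.2)
      (fun v hv i j k => sub_eq_zero.1 (hD φ hφ x hx v hv.2 i j k))
    ext v
    rw [← sum_smul_single v, map_sum]
    simp [h₁]
  · exact sub_eq_zero.2 ((C hφ).cartan_eq (fun u v huv => hhom.fderiv_eq_zero huv.1)
      (fun u v huv => hpar φ hφ u huv.1 v huv.2) ⟨hx, hy⟩ i j k)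
  · by_contra hne
    have hΩ : (x, y) ∈ chartDomain φ 𝒟 := ⟨hx, hy⟩
    have hopen := isOpen_chartDomain hφ h𝒟.isOpen
    have hcont := (smooth_hCovDeriv (C hφ).finsler (C hφ).smooth_b j k).continuousOn
    -- `W` is the open set where the chosen component `b_{j|k}` is nonzero. Either `b` is nonzero
    -- over some point of `W`, or `b` vanishes over all of `W`.
    set W : Set (Coord n × Coord n) := chartDomain φ 𝒟 ∩
      (fun p => hCovDeriv (localRep φ L) (localCovector φ b) j k p.1 p.2) ⁻¹' {0}ᶜ
    have hWopen : IsOpen W := hcont.isOpen_inter_preimage hopen isOpen_compl_singleton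
    have hWmem : (x, y) ∈ W := ⟨hΩ, hne⟩
    by_cases hex : ∃ p ∈ W, b (φ.symm p.1) ≠ 0
    · obtain ⟨p, hp, hbp⟩ := hex
      -- The effectiveness hypothesis places this point in the closure of the set where `f₂ ≠ 0`. As
      -- `W` corresponds to an open set of tangent vectors, it contains a point with `f₂ ≠ 0`, and
      -- there `b_{j|k} = 0`.
      have hcl := hdense (show tangentPoint φ p.1 p.2 ∈ {v ∈ 𝒟 | b v.1 ≠ 0} from ⟨hp.1.2, hbp⟩)
      have hsrc : φ.symm p.1 ∈ φ.source := φ.map_target hp.1.1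
      have hsopen : IsOpen {v : TangentBundle (𝓡 n) M | v.1 ∈ φ.source} :=
        φ.open_source.preimage (FiberBundle.continuous_proj _ _)
      obtain ⟨v, ⟨hvs, hvW⟩, hvD, hvf⟩ := mem_closure_iff.1 hcl _
        ((continuousOn_tangentCoord hφ).isOpen_inter_preimage hsopen hWopen)
        ⟨hsrc, by rw [Set.mem_preimage, tangentCoord_tangentPoint hφ hp.1.1]; exact hp⟩
      have hv := tangentPoint_tangentCoord hφ hvs
      replace hvW : tangentCoord φ v ∈ W := hvW
      generalize tangentCoord φ v = q at hv hvW
      refine hvW.2 ((C hφ).hCovDeriv_eq_zero hvW.1 (hhom.fderiv_eq_zero hvW.1.1)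
        (fun i j k => sub_eq_zero.1 (hD φ hφ _ hvW.1.1 _ hvW.1.2 i j k)) ?_ j k)
      rwa [conformal_oneForm_eq hv]
    · push Not at hex
      -- Here `b` vanishes over `W`. For `u` near `x` with `y` fixed, `(u, y)` remains in `W`, so `b
      -- = 0` near `x` and its covariant derivative at `x` is zero.
      have hcy : Filter.Tendsto (fun u : Coord n => (u, y)) (nhds x) (nhds (x, y)) :=
        (Continuous.prodMk_left y).tendsto x
      refine hne (hCovDeriv_eq_zero_of_eventuallyEq ?_ j k y)
      filter_upwards [hcy.eventually (hWopen.mem_nhds hWmem)] with u hu i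
      exact localCovector_eq_zero (hex _ hu) i
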